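/- Let $n\ge 1$ and $k>n$ be integers. Let $\mathbb H^n=\mathbb R^n\times\mathbb R^n\times\mathbb R$, with points $(x,y,t)$ and $z=x+iy\in\mathbb C^n$, be the Heisenberg group with group law $$(z,t)*(z',t')=\Big(z+z',\,t+t'+2\,\mathrm{Im}\sum_{j=1}^n z_j\overline{z_j'}\Big).$$ The Korányi metric is $d_K(p,q)=\|q^{-1}*p\|_K$, where $\|(z,t)\|_K=(|z|^4+t^2)^{1/4}$. The Carnot–Carathéodory metric $d_{cc}(p,q)$ is the infimum of $\int_a^b\big(\sum_{j=1}^n(u_j^2+v_j^2)\big)^{1/2}ds$ over all horizontal curves $\gamma:[a,b]\to\mathbb R^{2n+1}$ from $p$ to $q$, that is, absolutely continuous curves with $\gamma'=\sum_{j=1}^n\big(u_jX_j(\gamma)+v_jY_j(\gamma)\big)$ almost everywhere for some measurable $u_j,v_j$, where $X_j=\partial_{x_j}+2y_j\partial_t$ and $Y_j=\partial_{y_j}-2x_j\partial_t$. Let $d$ be either of the metrics $d_{cc}$, $d_K$. Then for every Lebesgue measurable set $E\subset\mathbb R^k$ and every Lipschitz map $f:E\to(\mathbb H^n,d)$ we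 have $\mathcal H^k_d(f(E))=0$, where $\mathcal H^k_d$ is the $k$-dimensional Hausdorff measure with respect to $d$. In other words, $(\mathbb H^n,d)$ is purely $k$-unrectifiable. -/

import Mathlib

open MeasureTheory Set Filter Topology
open scoped NNReal ENNReal

/-- A metric space `X` is purely `k`-unrectifiable if `ℋ^k (f(E)) = 0` for every (Lebesgue)
measurable `E ⊆ ℝ^k` and every map `f` from `E` to `X` that is Lipschitz on `E`
(values of `f` outside `E` are irrelevant). -/
def PurelyUnrectifiable (k : ℕ) (X : Type*) [EMetricSpace X] [MeasurableSpace X]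
    [BorelSpace X] : Prop :=
  ∀ (E : Set (EuclideanSpace ℝ (Fin k))) (f : EuclideanSpace ℝ (Fin k) → X),
    NullMeasurableSet E volume → (∃ L : ℝ≥0, LipschitzOnWith L f E) →
      Measure.hausdorffMeasure (k : ℝ) (f '' E) = 0

/-- The Heisenberg group `ℍ^n`: points `(x, y, t)` of `ℝ^n × ℝ^n × ℝ = ℝ^{2n+1}`, where
`z = x + i y ∈ ℂ^n`. -/
@[ext]
structure Heisenberg (n : ℕ) where
  x : Fin n → ℝ
  y : Fin n → ℝ
  t : ℝ

namespace Heisenberg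

variable {n : ℕ}

/-- The group law `(z, t) * (z', t') = (z + z', t + t' + 2 Im ∑ z_j * conj z'_j)`. -/
instance : Mul (Heisenberg n) :=
  ⟨fun p q => ⟨p.x + q.x, p.y + q.y,
    p.t + q.t + 2 * ∑ i, (p.y i * q.x i - p.x i * q.y i)⟩⟩

instance : One (Heisenberg n) := ⟨⟨0, 0, 0⟩⟩

instance : Inv (Heisenberg n) := ⟨fun p => ⟨-p.x, -p.y, -p.t⟩⟩

@[simp] theorem mul_x (p q : Heisenberg n) : (p * q).x = p.x + q.x := rfl
@[simp] theorem mul_y (p q : Heisenberg n) : (p * q).y = p.y + q.y := rfl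
@[simp] theorem mul_t (p q : Heisenberg n) :
    (p * q).t = p.t + q.t + 2 * ∑ i, (p.y i * q.x i - p.x i * q.y i) := rfl
@[simp] theorem one_x : (1 : Heisenberg n).x = 0 := rfl
@[simp] theorem one_y : (1 : Heisenberg n).y = 0 := rfl
@[simp] theorem one_t : (1 : Heisenberg n).t = 0 := rfl
@[simp] theorem inv_x (p : Heisenberg n) : p⁻¹.x = -p.x := rfl
@[simp] theorem inv_y (p : Heisenberg n) : p⁻¹.y = -p.y := rfl
@[simp] theorem inv_t (p : Heisenberg n) : p⁻¹.t = -p.t := rfl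

instance : Group (Heisenberg n) :=
  Group.ofLeftAxioms
    (by
      intro p q r
      ext i
      · simp [add_assoc]
      · simp [add_assoc]
      · simp only [mul_t, mul_x, mul_y, Pi.add_apply]
        have : ∑ i, ((p.y i + q.y i) * r.x i - (p.x i + q.x i) * r.y i)
              + ∑ i, (p.y i * q.x i - p.x i * q.y i)
            = ∑ i, (p.y i * (q.x i + r.x i) - p.x i * (q.y i + r.y i))
              + ∑ i, (q.y i * r.x i - q.x i * r.y i) := by
          rw [← Finset.sum_add_distrib, ← Finset.sum_add_distrib]
          exact Finset.sum_congr rfl fun i _ => by ring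
        linarith)
    (by intro p; ext i <;> simp)
    (by
      intro p
      ext i
      · simp
      · simp
      · have : ∑ i, (p⁻¹.y i * p.x i - p⁻¹.x i * p.y i) = 0 :=
          Finset.sum_eq_zero fun i _ => by simp; ring
        simp only [mul_t, this, inv_t, one_t]
        ring)

/-- The Korányi gauge `‖(z, t)‖ = (|z|^4 + t^2)^{1/4}`. -/
noncomputable def koranyiNorm (p : Heisenberg n) : ℝ :=
  ((∑ i, (p.x i ^ 2 + p.y i ^ 2)) ^ 2 + p.t ^ 2) ^ (1 / 4 : ℝ)

/-- The Korányi distance `d_K(p, q) = ‖q⁻¹ * p‖`. -/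
noncomputable def koranyiDist (p q : Heisenberg n) : ℝ := koranyiNorm (q⁻¹ * p)

theorem koranyiNorm_eq (p : Heisenberg n) :
    koranyiNorm p = √‖(⟨∑ i, (p.x i ^ 2 + p.y i ^ 2), p.t⟩ : ℂ)‖ := by
  rw [koranyiNorm, Complex.norm_def, Complex.normSq_mk, Real.sqrt_eq_rpow, Real.sqrt_eq_rpow,
    ← Real.rpow_mul (add_nonneg (mul_self_nonneg _) (mul_self_nonneg _))]
  norm_num [sq]

theorem koranyiNorm_one : koranyiNorm (1 : Heisenberg n) = 0 := by
  simp [koranyiNorm]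

theorem koranyiNorm_inv (p : Heisenberg n) : koranyiNorm p⁻¹ = koranyiNorm p := by
  simp [koranyiNorm]

theorem eq_one_of_koranyiNorm_eq_zero {p : Heisenberg n} (h : koranyiNorm p = 0) : p = 1 := by
  rw [koranyiNorm_eq, Real.sqrt_eq_zero (norm_nonneg _), norm_eq_zero, Complex.ext_iff] at h
  obtain ⟨h1, h2⟩ := h
  simp only [Complex.zero_re, Complex.zero_im] at h1 h2
  rw [Finset.sum_eq_zero_iff_of_nonneg (fun i _ => by positivity)] at h1
  ext i
  · have := h1 i (Finset.mem_univ _)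
    simp only [one_x, Pi.zero_apply]
    nlinarith [sq_nonneg (p.x i), sq_nonneg (p.y i)]
  · have := h1 i (Finset.mem_univ _)
    simp only [one_y, Pi.zero_apply]
    nlinarith [sq_nonneg (p.x i), sq_nonneg (p.y i)]
  · simpa using h2

theorem koranyiNorm_mul_le (p q : Heisenberg n) :
    koranyiNorm (p * q) ≤ koranyiNorm p + koranyiNorm q := by
  have key : ∀ r : Heisenberg n, 0 ≤ koranyiNorm r ∧
      koranyiNorm r ^ 2 = ‖(⟨∑ i, (r.x i ^ 2 + r.y i ^ 2), r.t⟩ : ℂ)‖ := fun r => by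
    rw [koranyiNorm_eq]
    exact ⟨Real.sqrt_nonneg _, Real.sq_sqrt (norm_nonneg _)⟩
  let z : Heisenberg n → EuclideanSpace ℂ (Fin n) := fun r => WithLp.toLp 2 fun i => ⟨r.x i, r.y i⟩
  have hz : ∀ r : Heisenberg n, ‖z r‖ ≤ koranyiNorm r := fun r => by
    refine le_of_sq_le_sq ?_ (key r).1
    rw [(key r).2, EuclideanSpace.norm_sq_eq]
    refine le_trans (le_of_eq ?_) (Complex.re_le_norm _)
    simp only [z]
    refine Finset.sum_congr rfl fun i _ => ?_
    rw [Complex.sq_norm, Complex.normSq_mk]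
    ring
  have hsplit : (⟨∑ i, ((p * q).x i ^ 2 + (p * q).y i ^ 2), (p * q).t⟩ : ℂ)
      = ⟨∑ i, (p.x i ^ 2 + p.y i ^ 2), p.t⟩ + ⟨∑ i, (q.x i ^ 2 + q.y i ^ 2), q.t⟩
        + 2 * inner ℂ (z q) (z p) := by
    have hin : inner ℂ (z q) (z p) = (⟨∑ i, (p.x i * q.x i + p.y i * q.y i),
        ∑ i, (p.y i * q.x i - p.x i * q.y i)⟩ : ℂ) := by
      rw [PiLp.inner_apply]
      apply Complex.ext
      · rw [Complex.re_sum]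
        refine Finset.sum_congr rfl fun i _ => ?_
        simp [z]
      · rw [Complex.im_sum]
        refine Finset.sum_congr rfl fun i _ => ?_
        simp [z]
        ring
    rw [hin]
    apply Complex.ext
    · simp only [mul_x, mul_y, Pi.add_apply, Complex.add_re, Complex.mul_re, Complex.re_ofNat,
        Complex.im_ofNat, zero_mul, sub_zero]
      rw [Finset.mul_sum, ← Finset.sum_add_distrib, ← Finset.sum_add_distrib]
      exact Finset.sum_congr rfl fun i _ => by ring
    · simp
  refine le_of_sq_le_sq ?_ (add_nonneg (key p).1 (key q).1)
  rw [(key (p * q)).2, hsplit]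
  refine (norm_add_le _ _).trans ((add_le_add_left (norm_add_le _ _) _).trans ?_)
  rw [← (key p).2, ← (key q).2, norm_mul]
  have h1 : ‖inner ℂ (z q) (z p)‖ ≤ koranyiNorm q * koranyiNorm p :=
    (norm_inner_le_norm _ _).trans
      (mul_le_mul (hz q) (hz p) (norm_nonneg _) (key q).1)
  have h2 : ‖(2 : ℂ)‖ = 2 := by simp
  rw [h2]
  nlinarith

/-! ### Horizontal curves and the Carnot–Carathéodory distance -/

/-- `γ` is an absolutely continuous curve on `[a, b]` (as a curve in `ℝ^{2n+1}`) with
`γ'(s) = ∑ i, (u_i(s) X_i(γ(s)) + v_i(s) Y_i(γ(s)))` for almost every `s ∈ [a, b]`, where `u_i`,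
`v_i` are measurable and `X_i = ∂/∂x_i + 2 y_i ∂/∂t`, `Y_i = ∂/∂y_i - 2 x_i ∂/∂t` are the
left-invariant horizontal vector fields. -/
structure IsHorizontalCurve (γ : ℝ → Heisenberg n) (u v : ℝ → Fin n → ℝ) (a b : ℝ) : Prop where
  le : a ≤ b
  ac_x : ∀ i, AbsolutelyContinuousOnInterval (fun s => (γ s).x i) a b
  ac_y : ∀ i, AbsolutelyContinuousOnInterval (fun s => (γ s).y i) a b
  ac_t : AbsolutelyContinuousOnInterval (fun s => (γ s).t) a b
  measurable_u : Measurable u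
  measurable_v : Measurable v
  deriv_x : ∀ᵐ s, s ∈ Icc a b → ∀ i, HasDerivAt (fun r => (γ r).x i) (u s i) s
  deriv_y : ∀ᵐ s, s ∈ Icc a b → ∀ i, HasDerivAt (fun r => (γ r).y i) (v s i) s
  deriv_t : ∀ᵐ s, s ∈ Icc a b → HasDerivAt (fun r => (γ r).t)
    (∑ i, (u s i * (2 * (γ s).y i) + v s i * (-(2 * (γ s).x i)))) s

/-- The horizontal length `∫_a^b (∑ i, (u_i^2 + v_i^2))^{1/2} ds` of a horizontal curve with
coefficients `u`, `v`. -/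
noncomputable def horizontalLength (u v : ℝ → Fin n → ℝ) (a b : ℝ) : ℝ≥0∞ :=
  ∫⁻ s in Icc a b, ENNReal.ofReal √(∑ i, (u s i ^ 2 + v s i ^ 2))

/-- The Carnot–Carathéodory distance: the infimum of the horizontal lengths of all horizontal
curves from `p` to `q`. For `n ≥ 1` it is finite, see `ccDist_ne_top`. -/
noncomputable def ccDist (p q : Heisenberg n) : ℝ≥0∞ :=
  sInf {ℓ | ∃ (γ : ℝ → Heisenberg n) (u v : ℝ → Fin n → ℝ) (a b : ℝ),
    IsHorizontalCurve γ u v a b ∧ γ a = p ∧ γ b = q ∧ horizontalLength u v a b = ℓ}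

theorem ac_congr {f g : ℝ → ℝ} {a b : ℝ} (hf : AbsolutelyContinuousOnInterval f a b)
    (h : ∀ s ∈ uIcc a b, f s = g s) : AbsolutelyContinuousOnInterval g a b := by
  rw [absolutelyContinuousOnInterval_iff] at hf ⊢
  intro ε hε
  obtain ⟨δ, hδ, H⟩ := hf ε hε
  refine ⟨δ, hδ, fun E hE hlt => ?_⟩
  convert H E hE hlt using 1
  refine Finset.sum_congr rfl fun i hi => ?_
  rw [h _ (hE.1 i hi).1, h _ (hE.1 i hi).2]

theorem ac_of_integral {f g : ℝ → ℝ} {a b c : ℝ} (hg : IntervalIntegrable g volume a b)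
    (h : ∀ s ∈ uIcc a b, f s = c + ∫ r in a..s, g r) : AbsolutelyContinuousOnInterval f a b := by
  have h1 := hg.absolutelyContinuousOnInterval_intervalIntegral (c := a) (by simp)
  have h2 : AbsolutelyContinuousOnInterval (fun _ : ℝ => c) a b :=
    (LipschitzWith.const c).lipschitzOnWith.absolutelyContinuousOnInterval
  exact ac_congr (h2.add h1) fun s hs => by rw [h s hs]; rfl

theorem eq_add_integral_of_ac {f : ℝ → ℝ} {a b : ℝ} (hf : AbsolutelyContinuousOnInterval f a b)
    {s : ℝ} (hs : s ∈ uIcc a b) : f s = f a + ∫ r in a..s, deriv f r := by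
  rw [(hf.mono (uIcc_subset_uIcc_left hs)).integral_deriv_eq_sub]
  ring

theorem ac_reflect {f : ℝ → ℝ} {a b : ℝ} (hf : AbsolutelyContinuousOnInterval f a b) (c : ℝ) :
    AbsolutelyContinuousOnInterval (fun s => f (c - s)) (c - a) (c - b) := by
  have hi := hf.intervalIntegrable_deriv
  refine ac_of_integral (g := fun s => -deriv f (c - s)) (c := f a) (hi.comp_sub_left c).neg ?_
  intro s hs
  have hs' : c - s ∈ uIcc a b := by
    rw [← sub_sub_cancel c a, ← sub_sub_cancel c b, ← Set.image_const_sub_uIcc]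
    exact ⟨s, hs, rfl⟩
  rw [eq_add_integral_of_ac hf hs', intervalIntegral.integral_neg,
    intervalIntegral.integral_comp_sub_left (fun r => deriv f r), sub_sub_cancel,
    intervalIntegral.integral_symm a, neg_neg]

theorem ac_concat {f g : ℝ → ℝ} {a b c : ℝ} (hab : a ≤ b) (hbc : b ≤ c)
    (hf : AbsolutelyContinuousOnInterval f a b) (hg : AbsolutelyContinuousOnInterval g b c)
    (h : f b = g b) :
    AbsolutelyContinuousOnInterval (fun s => if s ≤ b then f s else g s) a c := by
  set G : ℝ → ℝ := fun s => if s ≤ b then deriv f s else deriv g s with hG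
  have i1 : IntervalIntegrable G volume a b :=
    hf.intervalIntegrable_deriv.congr fun r hr => by
      rw [uIoc_of_le hab] at hr
      simp [hG, hr.2]
  have i2 : IntervalIntegrable G volume b c :=
    hg.intervalIntegrable_deriv.congr fun r hr => by
      rw [uIoc_of_le hbc] at hr
      simp [hG, not_le.2 hr.1]
  refine ac_of_integral (g := G) (c := f a) (i1.trans i2) ?_
  intro s hs
  rw [uIcc_of_le (hab.trans hbc)] at hs
  by_cases hsb : s ≤ b
  · have hs' : s ∈ uIcc a b := by rw [uIcc_of_le hab]; exact ⟨hs.1, hsb⟩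
    simp only [hsb, if_true]
    rw [eq_add_integral_of_ac hf hs']
    congr 1
    refine intervalIntegral.integral_congr_ae (ae_of_all _ fun r hr => ?_)
    rw [uIoc_of_le hs.1] at hr
    simp [hG, hr.2.trans hsb]
  · have hbs : b ≤ s := (not_le.1 hsb).le
    have hs' : s ∈ uIcc b c := by rw [uIcc_of_le hbc]; exact ⟨hbs, hs.2⟩
    simp only [hsb, if_false]
    rw [← intervalIntegral.integral_add_adjacent_intervals i1
        (i2.mono_set (uIcc_subset_uIcc_left hs')), eq_add_integral_of_ac hg hs', ← h,
      eq_add_integral_of_ac hf (right_mem_uIcc : b ∈ uIcc a b), add_assoc]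
    congr 2
    · refine intervalIntegral.integral_congr_ae (ae_of_all _ fun r hr => ?_)
      rw [uIoc_of_le hab] at hr
      simp [hG, hr.2]
    · refine intervalIntegral.integral_congr_ae (ae_of_all _ fun r hr => ?_)
      rw [uIoc_of_le hbs] at hr
      simp [hG, not_le.2 hr.1]

theorem ae_reflect {P : ℝ → Prop} (h : ∀ᵐ s, P s) (c : ℝ) : ∀ᵐ s : ℝ, P (c - s) :=
  (Measure.measurePreserving_sub_left volume c).quasiMeasurePreserving.ae h

theorem IsHorizontalCurve.reflect {γ : ℝ → Heisenberg n} {u v : ℝ → Fin n → ℝ} {a b : ℝ}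
    (h : IsHorizontalCurve γ u v a b) (c : ℝ) :
    IsHorizontalCurve (fun s => γ (c - s)) (fun s => -u (c - s)) (fun s => -v (c - s))
      (c - b) (c - a) where
  le := by linarith [h.le]
  ac_x i := (ac_reflect (h.ac_x i) c).symm
  ac_y i := (ac_reflect (h.ac_y i) c).symm
  ac_t := (ac_reflect h.ac_t c).symm
  measurable_u := (h.measurable_u.comp (measurable_const.sub measurable_id)).neg
  measurable_v := (h.measurable_v.comp (measurable_const.sub measurable_id)).neg
  deriv_x := by
    filter_upwards [ae_reflect h.deriv_x c] with s hs hm i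
    have := HasDerivAt.comp_const_sub c s (hs ⟨by linarith [hm.2], by linarith [hm.1]⟩ i)
    exact this
  deriv_y := by
    filter_upwards [ae_reflect h.deriv_y c] with s hs hm i
    have := HasDerivAt.comp_const_sub c s (hs ⟨by linarith [hm.2], by linarith [hm.1]⟩ i)
    exact this
  deriv_t := by
    filter_upwards [ae_reflect h.deriv_t c] with s hs hm
    have := HasDerivAt.comp_const_sub c s (hs ⟨by linarith [hm.2], by linarith [hm.1]⟩)
    refine HasDerivAt.congr_deriv this ?_
    rw [← Finset.sum_neg_distrib]
    refine Finset.sum_congr rfl fun i _ => ?_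
    simp only [Pi.neg_apply]
    ring

theorem horizontalLength_reflect (u v : ℝ → Fin n → ℝ) (a b c : ℝ) :
    horizontalLength (fun s => -u (c - s)) (fun s => -v (c - s)) (c - b) (c - a)
      = horizontalLength u v a b := by
  have h := (Measure.measurePreserving_sub_left (volume : Measure ℝ) c).setLIntegral_comp_preimage_emb
    (MeasurableEquiv.subLeft c).measurableEmbedding
    (fun s => ENNReal.ofReal √(∑ i, (u s i ^ 2 + v s i ^ 2))) (Icc a b)
  rw [Set.preimage_const_sub_Icc] at h
  simpa [horizontalLength] using h

theorem IsHorizontalCurve.concat {γ γ' : ℝ → Heisenberg n} {u v u' v' : ℝ → Fin n → ℝ}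
    {a b c : ℝ} (h : IsHorizontalCurve γ u v a b) (h' : IsHorizontalCurve γ' u' v' b c)
    (hb : γ b = γ' b) :
    IsHorizontalCurve (fun s => if s ≤ b then γ s else γ' s) (fun s => if s ≤ b then u s else u' s)
      (fun s => if s ≤ b then v s else v' s) a c := by
  have hne : ∀ᵐ s : ℝ, s ≠ b := by simp [ae_iff]
  have key : ∀ (φ : Heisenberg n → ℝ) (s d d' : ℝ), s ∈ Icc a c → s ≠ b →
      (s ∈ Icc a b → HasDerivAt (fun r => φ (γ r)) d s) →
      (s ∈ Icc b c → HasDerivAt (fun r => φ (γ' r)) d' s) →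
      HasDerivAt (fun r => φ (if r ≤ b then γ r else γ' r)) (if s ≤ b then d else d') s := by
    intro φ s d d' hs hsb h1 h2
    rcases lt_or_gt_of_ne hsb with hlt | hgt
    · rw [if_pos hlt.le]
      refine (h1 ⟨hs.1, hlt.le⟩).congr_of_eventuallyEq ?_
      filter_upwards [eventually_lt_nhds hlt] with r hr
      rw [if_pos hr.le]
    · rw [if_neg (not_le.2 hgt)]
      refine (h2 ⟨hgt.le, hs.2⟩).congr_of_eventuallyEq ?_
      filter_upwards [eventually_gt_nhds hgt] with r hr
      rw [if_neg (not_le.2 hr)]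
  have hac : ∀ φ : Heisenberg n → ℝ,
      AbsolutelyContinuousOnInterval (fun s => φ (γ s)) a b →
      AbsolutelyContinuousOnInterval (fun s => φ (γ' s)) b c →
      AbsolutelyContinuousOnInterval (fun s => φ (if s ≤ b then γ s else γ' s)) a c := by
    intro φ h1 h2
    have h3 := ac_concat h.le h'.le h1 h2 (by rw [hb])
    refine ac_congr h3 fun s _ => ?_
    split_ifs <;> rfl
  refine ⟨h.le.trans h'.le, fun i => hac (fun p => p.x i) (h.ac_x i) (h'.ac_x i),
    fun i => hac (fun p => p.y i) (h.ac_y i) (h'.ac_y i), hac (fun p => p.t) h.ac_t h'.ac_t,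
    Measurable.ite measurableSet_Iic h.measurable_u h'.measurable_u,
    Measurable.ite measurableSet_Iic h.measurable_v h'.measurable_v, ?_, ?_, ?_⟩
  · filter_upwards [hne, h.deriv_x, h'.deriv_x] with s hs h1 h2 hm i
    convert key (fun p => p.x i) s _ _ hm hs (fun hs => h1 hs i) (fun hs => h2 hs i) using 1
    split_ifs <;> rfl
  · filter_upwards [hne, h.deriv_y, h'.deriv_y] with s hs h1 h2 hm i
    convert key (fun p => p.y i) s _ _ hm hs (fun hs => h1 hs i) (fun hs => h2 hs i) using 1
    split_ifs <;> rfl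
  · filter_upwards [hne, h.deriv_t, h'.deriv_t] with s hs h1 h2 hm
    convert key (fun p => p.t) s _ _ hm hs h1 h2 using 1
    split_ifs <;> rfl

theorem horizontalLength_concat_le (u v u' v' : ℝ → Fin n → ℝ) (a b c : ℝ) :
    horizontalLength (fun s => if s ≤ b then u s else u' s)
      (fun s => if s ≤ b then v s else v' s) a c
      ≤ horizontalLength u v a b + horizontalLength u' v' b c := by
  have hsub : Icc a c ⊆ Icc a b ∪ Ioc b c := fun s hs => by
    rcases le_or_gt s b with h | h
    · exact Or.inl ⟨hs.1, h⟩
    · exact Or.inr ⟨h, hs.2⟩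
  refine (lintegral_mono_set hsub).trans ((lintegral_union_le _ _ _).trans (add_le_add ?_ ?_))
  · refine le_of_eq (setLIntegral_congr_fun measurableSet_Icc fun s hs => ?_)
    simp [hs.2]
  · refine le_trans (le_of_eq (setLIntegral_congr_fun measurableSet_Ioc fun s hs => ?_))
      (lintegral_mono_set Ioc_subset_Icc_self)
    simp [not_le.2 hs.1]

theorem ccDist_le {γ : ℝ → Heisenberg n} {u v : ℝ → Fin n → ℝ} {a b : ℝ}
    (h : IsHorizontalCurve γ u v a b) : ccDist (γ a) (γ b) ≤ horizontalLength u v a b :=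
  sInf_le ⟨γ, u, v, a, b, h, rfl, rfl, rfl⟩

theorem ccDist_comm_le (p q : Heisenberg n) : ccDist q p ≤ ccDist p q := by
  refine le_sInf ?_
  rintro _ ⟨γ, u, v, a, b, h, rfl, rfl, rfl⟩
  have := ccDist_le (h.reflect 0)
  simpa only [horizontalLength_reflect, sub_sub_cancel] using this

theorem ccDist_triangle (p q r : Heisenberg n) : ccDist p r ≤ ccDist p q + ccDist q r := by
  unfold ccDist
  rw [ENNReal.sInf_add]
  refine le_iInf₂ fun ℓ hℓ => ?_
  rw [add_comm, ENNReal.sInf_add]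
  refine le_iInf₂ fun ℓ' hℓ' => ?_
  obtain ⟨γ, u, v, a, b, h, rfl, hq, rfl⟩ := hℓ
  obtain ⟨γ', u', v', a', b', h', hq', rfl, rfl⟩ := hℓ'
  have h2 := (h'.reflect 0).reflect (b - a')
  rw [show b - a' - (0 - a') = b by ring] at h2
  have h3 := h.concat h2 (by simp [hq, hq'])
  have h4 := (ccDist_le h3).trans (horizontalLength_concat_le _ _ _ _ _ _ _)
  have h5 := horizontalLength_reflect (fun s => -u' (0 - s)) (fun s => -v' (0 - s))
    (0 - b') (0 - a') (b - a')
  rw [show b - a' - (0 - a') = b by ring, horizontalLength_reflect] at h5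
  rw [h5, add_comm] at h4
  refine le_trans (le_of_eq ?_) h4
  have hb' : b ≤ b - a' - (0 - b') := by linarith [h'.le]
  rw [← ccDist, if_pos h.le]
  congr 1
  by_cases hb : b - a' - (0 - b') ≤ b
  · have : b' = a' := by linarith [h'.le]
    subst this
    rw [if_pos hb]
    simp [hq, hq']
  · rw [if_neg hb]
    congr 1
    ring

theorem edist_le_of_ac {f g ℓ : ℝ → ℝ} {a b : ℝ} (K : ℝ≥0) (hab : a ≤ b)
    (hf : AbsolutelyContinuousOnInterval f a b)
    (hd : ∀ᵐ s, s ∈ Icc a b → HasDerivAt f (g s) s)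
    (hg : ∀ s ∈ Icc a b, |g s| ≤ K * ℓ s) :
    edist (f b) (f a) ≤ K * ∫⁻ s in Icc a b, ENNReal.ofReal (ℓ s) := by
  rw [edist_eq_enorm_sub, ← hf.integral_deriv_eq_sub, intervalIntegral.integral_of_le hab,
    ← lintegral_const_mul' _ _ ENNReal.coe_ne_top]
  refine (enorm_integral_le_lintegral_enorm _).trans ?_
  refine (lintegral_mono_set Ioc_subset_Icc_self).trans (lintegral_mono_ae ?_)
  rw [ae_restrict_iff' measurableSet_Icc]
  filter_upwards [hd] with s hs hm
  rw [(hs hm).deriv, ← ENNReal.ofReal_coe_nnreal, ← ENNReal.ofReal_mul K.coe_nonneg,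
    Real.enorm_eq_ofReal_abs]
  exact ENNReal.ofReal_le_ofReal (hg s hm)

theorem abs_le_sqrt_sum (u v : Fin n → ℝ) (i : Fin n) :
    |u i| ≤ √(∑ i, (u i ^ 2 + v i ^ 2)) ∧ |v i| ≤ √(∑ i, (u i ^ 2 + v i ^ 2)) := by
  have h := Finset.single_le_sum (f := fun i => u i ^ 2 + v i ^ 2)
    (fun i _ => by positivity) (Finset.mem_univ i)
  constructor
  · exact Real.abs_le_sqrt (le_trans (by nlinarith [sq_nonneg (v i)]) h)
  · exact Real.abs_le_sqrt (le_trans (by nlinarith [sq_nonneg (u i)]) h)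

theorem IsHorizontalCurve.edist_xy_le {γ : ℝ → Heisenberg n} {u v : ℝ → Fin n → ℝ} {a b : ℝ}
    (h : IsHorizontalCurve γ u v a b) {s : ℝ} (hs : s ∈ Icc a b) (i : Fin n) :
    edist ((γ s).x i) ((γ a).x i) ≤ horizontalLength u v a b ∧
      edist ((γ s).y i) ((γ a).y i) ≤ horizontalLength u v a b := by
  have hsub : uIcc a s ⊆ uIcc a b := by
    rw [uIcc_of_le h.le, uIcc_of_le hs.1]
    exact Icc_subset_Icc_right hs.2
  have hmono : ∫⁻ r in Icc a s, ENNReal.ofReal √(∑ i, (u r i ^ 2 + v r i ^ 2))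
      ≤ horizontalLength u v a b := lintegral_mono_set (Icc_subset_Icc_right hs.2)
  constructor
  · refine le_trans ?_ hmono
    have := edist_le_of_ac (g := fun r => u r i)
      (ℓ := fun r => √(∑ i, (u r i ^ 2 + v r i ^ 2))) 1 hs.1 ((h.ac_x i).mono hsub)
      (by filter_upwards [h.deriv_x] with r hr hm using hr ⟨hm.1, hm.2.trans hs.2⟩ i)
      (fun r _ => by simpa using (abs_le_sqrt_sum (u r) (v r) i).1)
    simpa using this
  · refine le_trans ?_ hmono
    have := edist_le_of_ac (g := fun r => v r i)
      (ℓ := fun r => √(∑ i, (u r i ^ 2 + v r i ^ 2))) 1 hs.1 ((h.ac_y i).mono hsub)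
      (by filter_upwards [h.deriv_y] with r hr hm using hr ⟨hm.1, hm.2.trans hs.2⟩ i)
      (fun r _ => by simpa using (abs_le_sqrt_sum (u r) (v r) i).2)
    simpa using this

theorem exists_edist_le_ccDist (p : Heisenberg n) :
    ∃ K : ℝ≥0, ∀ (γ : ℝ → Heisenberg n) (u v : ℝ → Fin n → ℝ) (a b : ℝ),
      IsHorizontalCurve γ u v a b → γ a = p → horizontalLength u v a b < 1 →
      edist (γ b).t p.t ≤ K * horizontalLength u v a b := by
  let M : ℝ := ∑ i, (|p.x i| + |p.y i|) + 1
  have hM : 0 ≤ M := by positivity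
  refine ⟨⟨∑ _i : Fin n, (4 * M), by positivity⟩, ?_⟩
  rintro γ u v a b h rfl hlt
  have hbd : ∀ s ∈ Icc a b, ∀ i, |(γ s).x i| ≤ M ∧ |(γ s).y i| ≤ M := by
    intro s hs i
    have h1 := h.edist_xy_le hs i
    have h2 : dist ((γ s).x i) ((γ a).x i) ≤ 1 := by
      have := (h1.1.trans_lt hlt).le
      rwa [edist_dist, ENNReal.ofReal_le_one] at this
    have h3 : dist ((γ s).y i) ((γ a).y i) ≤ 1 := by
      have := (h1.2.trans_lt hlt).le
      rwa [edist_dist, ENNReal.ofReal_le_one] at this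
    rw [Real.dist_eq] at h2 h3
    have h4 : |(γ a).x i| + |(γ a).y i| ≤ ∑ i, (|(γ a).x i| + |(γ a).y i|) :=
      Finset.single_le_sum (f := fun i => |(γ a).x i| + |(γ a).y i|)
        (fun i _ => by positivity) (Finset.mem_univ i)
    have h5 := abs_sub_abs_le_abs_sub ((γ s).x i) ((γ a).x i)
    have h6 := abs_sub_abs_le_abs_sub ((γ s).y i) ((γ a).y i)
    have h7 := abs_nonneg ((γ a).x i)
    have h8 := abs_nonneg ((γ a).y i)
    constructor <;> simp only [M] <;> linarith
  refine edist_le_of_ac (ℓ := fun r => √(∑ i, (u r i ^ 2 + v r i ^ 2))) _ h.le h.ac_t h.deriv_t ?_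
  intro s hs
  refine (Finset.abs_sum_le_sum_abs _ _).trans ?_
  change _ ≤ (∑ _i : Fin n, (4 * M)) * _
  rw [Finset.sum_mul]
  refine Finset.sum_le_sum fun i _ => ?_
  obtain ⟨h1, h2⟩ := abs_le_sqrt_sum (u s) (v s) i
  obtain ⟨h3, h4⟩ := hbd s hs i
  refine (abs_add_le _ _).trans ?_
  simp only [abs_mul, abs_neg, abs_two]
  have h5 := mul_le_mul h1 h4 (abs_nonneg _) (Real.sqrt_nonneg _)
  have h6 := mul_le_mul h2 h3 (abs_nonneg _) (Real.sqrt_nonneg _)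
  nlinarith

theorem eq_of_ccDist_eq_zero {p q : Heisenberg n} (h0 : ccDist p q = 0) : p = q := by
  obtain ⟨K, hK⟩ := exists_edist_le_ccDist p
  have key : ∀ ε : ℝ≥0∞, 0 < ε → ε ≤ 1 → (∀ i, edist (q.x i) (p.x i) ≤ ε) ∧
      (∀ i, edist (q.y i) (p.y i) ≤ ε) ∧ edist q.t p.t ≤ K * ε := by
    intro ε hε hε1
    rw [← h0] at hε
    obtain ⟨_, ⟨γ, u, v, a, b, h, rfl, rfl, rfl⟩, hlt⟩ := sInf_lt_iff.1 hε
    have hb : b ∈ Icc a b := ⟨h.le, le_rfl⟩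
    exact ⟨fun i => (h.edist_xy_le hb i).1.trans hlt.le,
      fun i => (h.edist_xy_le hb i).2.trans hlt.le,
      (hK γ u v a b h rfl (hlt.trans_le hε1)).trans (mul_le_mul_right hlt.le _)⟩
  have lim : ∀ (C : ℝ≥0) (d : ℝ≥0∞), (∀ ε : ℝ≥0∞, 0 < ε → ε ≤ 1 → d ≤ C * ε) → d = 0 := by
    intro C d h
    have h1 : Tendsto (fun ε : ℝ≥0∞ => C * ε) (𝓝[>] 0) (𝓝 (C * 0)) :=
      (ENNReal.Tendsto.const_mul tendsto_id (Or.inr ENNReal.coe_ne_top)).mono_left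
        nhdsWithin_le_nhds
    rw [mul_zero] at h1
    refine le_antisymm (ge_of_tendsto h1 ?_) (zero_le)
    filter_upwards [Ioo_mem_nhdsGT (zero_lt_one (α := ℝ≥0∞))] with ε hε
    exact h ε hε.1 hε.2.le
  ext i
  · exact (edist_eq_zero.1 (lim 1 _ fun ε h h' => by simpa using (key ε h h').1 i)).symm
  · exact (edist_eq_zero.1 (lim 1 _ fun ε h h' => by simpa using (key ε h h').2.1 i)).symm
  · exact (edist_eq_zero.1 (lim K _ fun ε h h' => (key ε h h').2.2)).symm

theorem isHorizontalCurve_line (p : Heisenberg n) (u v : Fin n → ℝ) :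
    IsHorizontalCurve (fun s => p * ⟨s • u, s • v, 0⟩) (fun _ => u) (fun _ => v) 0 1 := by
  have hx : ∀ (i : Fin n) (s : ℝ),
      HasDerivAt (fun r : ℝ => (p * ⟨r • u, r • v, 0⟩ : Heisenberg n).x i) (u i) s := by
    intro i s
    simpa using ((hasDerivAt_id s).mul_const (u i)).const_add (p.x i)
  have hy : ∀ (i : Fin n) (s : ℝ),
      HasDerivAt (fun r : ℝ => (p * ⟨r • u, r • v, 0⟩ : Heisenberg n).y i) (v i) s := by
    intro i s
    simpa using ((hasDerivAt_id s).mul_const (v i)).const_add (p.y i)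
  have heq : ∀ r : ℝ, (p * ⟨r • u, r • v, 0⟩ : Heisenberg n).t
      = p.t + r * (2 * ∑ i, (p.y i * u i - p.x i * v i)) := by
    intro r
    simp only [mul_t, Pi.smul_apply, smul_eq_mul, add_zero, Finset.mul_sum]
    congr 1
    exact Finset.sum_congr rfl fun i _ => by ring
  have ht : ∀ s : ℝ, HasDerivAt (fun r : ℝ => (p * ⟨r • u, r • v, 0⟩ : Heisenberg n).t)
      (2 * ∑ i, (p.y i * u i - p.x i * v i)) s := by
    intro s
    simp only [heq]
    simpa using ((hasDerivAt_id s).mul_const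
      (2 * ∑ i, (p.y i * u i - p.x i * v i))).const_add p.t
  have hac : ∀ (f : ℝ → ℝ) (d : ℝ), (∀ s, HasDerivAt f d s) →
      AbsolutelyContinuousOnInterval f 0 1 := by
    intro f d hf
    have hd : deriv f = fun _ => d := funext fun s => (hf s).deriv
    exact ContDiffOn.absolutelyContinuousOnInterval (contDiff_one_iff_deriv.2
      ⟨fun s => (hf s).differentiableAt, hd ▸ continuous_const⟩).contDiffOn
  refine ⟨zero_le_one, fun i => hac _ _ (hx i), fun i => hac _ _ (hy i), hac _ _ ht,
    measurable_const, measurable_const, ae_of_all _ fun s _ i => hx i s,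
    ae_of_all _ fun s _ i => hy i s, ae_of_all _ fun s _ => ?_⟩
  convert ht s using 1
  rw [Finset.mul_sum]
  refine Finset.sum_congr rfl fun i _ => ?_
  simp only [mul_x, mul_y, Pi.add_apply, Pi.smul_apply, smul_eq_mul]
  ring

theorem ccDist_mul_ne_top (p : Heisenberg n) (u v : Fin n → ℝ) :
    ccDist p (p * ⟨u, v, 0⟩) ≠ ⊤ := by
  have h := ccDist_le (isHorizontalCurve_line p u v)
  have h0 : p * (⟨0, 0, 0⟩ : Heisenberg n) = p := mul_one p
  simp only [one_smul, zero_smul, h0] at h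
  refine ne_top_of_le_ne_top ?_ h
  simp [horizontalLength]

theorem ccDist_ne_top (hn : 0 < n) (p q : Heisenberg n) : ccDist p q ≠ ⊤ := by
  have htri : ∀ {p q r : Heisenberg n}, ccDist p q ≠ ⊤ → ccDist q r ≠ ⊤ → ccDist p r ≠ ⊤ :=
    fun h1 h2 => ne_top_of_le_ne_top (ENNReal.add_ne_top.2 ⟨h1, h2⟩) (ccDist_triangle _ _ _)
  set e : Fin n → ℝ := Pi.single ⟨0, hn⟩ 1 with he
  set w : Heisenberg n := p * ⟨q.x - p.x, q.y - p.y, 0⟩ with hw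
  set β : ℝ := (q.t - w.t) / 4 with hβ
  refine htri (ccDist_mul_ne_top p (q.x - p.x) (q.y - p.y)) ?_
  refine htri (ccDist_mul_ne_top w 0 e) ?_
  refine htri (ccDist_mul_ne_top _ (β • e) 0) ?_
  refine htri (ccDist_mul_ne_top _ 0 (-e)) ?_
  convert ccDist_mul_ne_top _ (-(β • e)) 0 using 2
  ext i
  · simp [hw]
  · simp [hw]
  · have hsum : ∀ f : Fin n → ℝ, ∑ j, f j * e j = f ⟨0, hn⟩ := by
      intro f
      simp [he, Pi.single_apply]
    have hee : e ⟨0, hn⟩ = 1 := by simp [he]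
    have h3 := hsum fun j => 2 * β * e j
    have h4 : (∑ j, (w.y j * (0 : ℝ) - w.x j * e j))
        + (∑ j, ((w.y j + e j) * (β * e j) - (w.x j + 0) * 0))
        + (∑ j, ((w.y j + e j + 0) * 0 - (w.x j + 0 + β * e j) * -e j))
        + (∑ j, ((w.y j + e j + 0 + -e j) * -(β * e j) - (w.x j + 0 + β * e j + 0) * 0))
        = ∑ j, 2 * β * e j * e j := by
      simp only [← Finset.sum_add_distrib]
      exact Finset.sum_congr rfl fun j _ => by ring
    simp only [hee] at h3
    simp only [mul_t, mul_x, mul_y, Pi.add_apply, Pi.neg_apply, Pi.smul_apply, Pi.zero_apply,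
      smul_eq_mul]
    rw [h3] at h4
    linarith

/-- `ℍ^n` with the Carnot–Carathéodory metric. -/
@[ext]
structure CC (n : ℕ) where
  pt : Heisenberg n

/-- `ℍ^n` with the Korányi metric. -/
@[ext]
structure Koranyi (n : ℕ) where
  pt : Heisenberg n

noncomputable instance : EMetricSpace (CC n) where
  edist p q := ccDist p.pt q.pt
  edist_self p := by
    have h := ccDist_le (isHorizontalCurve_line p.pt 0 0)
    have h0 : p.pt * (⟨0, 0, 0⟩ : Heisenberg n) = p.pt := mul_one p.pt
    simp only [smul_zero, h0] at h
    exact le_antisymm (h.trans (by simp [horizontalLength])) zero_le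
  edist_comm p q := le_antisymm (ccDist_comm_le _ _) (ccDist_comm_le _ _)
  edist_triangle p q r := ccDist_triangle _ _ _
  eq_of_edist_eq_zero h := CC.ext (eq_of_ccDist_eq_zero h)

noncomputable instance : MetricSpace (Koranyi n) where
  dist p q := koranyiDist p.pt q.pt
  dist_self p := by rw [koranyiDist, inv_mul_cancel, koranyiNorm_one]
  dist_comm p q := by
    rw [koranyiDist, koranyiDist, ← koranyiNorm_inv, mul_inv_rev, inv_inv]
  dist_triangle p q r := by
    have h := koranyiNorm_mul_le (r.pt⁻¹ * q.pt) (q.pt⁻¹ * p.pt)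
    rw [mul_assoc, mul_inv_cancel_left] at h
    rw [add_comm]
    exact h
  eq_of_dist_eq_zero h :=
    Koranyi.ext (inv_mul_eq_one.1 (eq_one_of_koranyiNorm_eq_zero h)).symm

noncomputable instance : MeasurableSpace (CC n) := borel _
instance : BorelSpace (CC n) := ⟨rfl⟩
noncomputable instance : MeasurableSpace (Koranyi n) := borel _
instance : BorelSpace (Koranyi n) := ⟨rfl⟩

end Heisenberg

/-! ### Differentiability of maps satisfying a quadratic contact estimate -/

/-! A Lipschitz map `f` into `ℍ^n` has a Lipschitz horizontal part `F` with values in `ℝ^{2n}`, so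
Rademacher's theorem gives `F` a derivative `A` at almost every point of `E`. The geometric fact is
that `A` has isotropic range for the symplectic form at density points. Isotropic subspaces have
dimension at most `n < k`, so `A` has rank less than `k` and the image should be negligible in
dimension `k`.

The Lipschitz bound only makes the vertical part of `f(q)⁻¹ f(q')` of size `O(|q - q'|²)`, which is
comparable to the horizontal size after taking square roots. At a density point this improves to
`o(r²)`: walking from `p` to `q` through `N` intermediate points of `E` costs `N · O((r/N)²)`, and
the symplectic terms nearly vanish because all increments are almost parallel
(`eventually_abs_contactDefect_le`). Comparing two directions then forces isotropy
(`bilin_fderivWithin_eq_zero`), and isotropy extends the improved bound to all pairs of points near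
`p` (`eventually_norm_sub_le_and_abs_contactDefect_le`).

Hence at scale `r` the map `f` expands no more than a linear map of rank `j < k`, up to `o(r)`. The
image of an `r`-ball is covered by about `m^j` sets of diameter about `r/m`, with `k`-th powers
adding up to `O(m^{j-k} r^k)` (`hasSmallCovers_of_rank_lt`). A Besicovitch covering sums this over
`E` (`hausdorffMeasure_image_eq_zero`). The Carnot–Carathéodory case follows since the two metrics
are bi-Lipschitz equivalent. -/

section Contact

variable {W V : Type*} [NormedAddCommGroup W] [NormedSpace ℝ W] [NormedAddCommGroup V]
  [NormedSpace ℝ V]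

/-- The set `E` is asymptotically dense at `p`: at small scales `r`, every point of the ball of
radius `r` around `p` is much closer than `r` to `E`. -/
def AsymptoticallyDenseAt (E : Set W) (p : W) : Prop :=
  ∀ δ > 0, ∀ᶠ r : ℝ in 𝓝[>] 0, ∀ w, dist w p ≤ r → ∃ q ∈ E, dist q w ≤ δ * r

/-- The failure of the pair `(F, τ)` to be horizontal between `q` and `q'`; for the coordinates of
a map into the Heisenberg group this is the last coordinate of the group quotient. -/
noncomputable def contactDefect {W : Type*} (ω : V →L[ℝ] V →L[ℝ] ℝ) (F : W → V) (τ : W → ℝ) (q q' : W) : ℝ :=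
  τ q' - τ q - ω (F q) (F q')

/-- This is the group law read on last coordinates, for `f(a)⁻¹ f(c) = (f(a)⁻¹ f(b)) (f(b)⁻¹ f(c))`.
It lets defects be summed along chains. -/
theorem contactDefect_add {W : Type*} (ω : V →L[ℝ] V →L[ℝ] ℝ) (hω : ∀ v, ω v v = 0) (F : W → V) (τ : W → ℝ)
    (a b c : W) : contactDefect ω F τ a c = contactDefect ω F τ a b + contactDefect ω F τ b c
      + ω (F b - F a) (F c - F b) := by
  simp only [contactDefect, map_sub, _root_.sub_apply, hω]
  ring

theorem abs_bilin_sub_le (ω : V →L[ℝ] V →L[ℝ] ℝ) {u v u' v' : V} {M η : ℝ} (hu : ‖u‖ ≤ M)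
    (hv : ‖v‖ ≤ M) (hu' : ‖u' - u‖ ≤ η) (hv' : ‖v' - v‖ ≤ η) :
    |ω u' v' - ω u v| ≤ ‖ω‖ * (2 * M * η + η ^ 2) := by
  have hM : 0 ≤ M := (norm_nonneg _).trans hu
  have hη : 0 ≤ η := (norm_nonneg _).trans hu'
  have e : ω u' v' - ω u v = ω u (v' - v) + ω (u' - u) v + ω (u' - u) (v' - v) := by
    simp only [map_sub, _root_.sub_apply]
    ring
  have key : ∀ {x y : V} {X Y : ℝ}, ‖x‖ ≤ X → ‖y‖ ≤ Y → |ω x y| ≤ ‖ω‖ * (X * Y) := by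
    intro x y X Y hx hy
    have hX : 0 ≤ X := (norm_nonneg _).trans hx
    rw [← mul_assoc]
    exact (ω.le_opNorm₂ x y).trans (by gcongr)
  rw [e]
  calc _ ≤ |ω u (v' - v)| + |ω (u' - u) v| + |ω (u' - u) (v' - v)| := abs_add_three _ _ _
    _ ≤ ‖ω‖ * (M * η) + ‖ω‖ * (η * M) + ‖ω‖ * (η * η) :=
      add_le_add (add_le_add (key hu hv') (key hu' hv)) (key hu' hv')
    _ = _ := by ring

/-- Evaluates the bound of `abs_bilin_sub_le` at `M = a r` and `η = 2 d r (1 + a)`, where `a` will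
be `‖A‖` and `d` the relative precision: the error is linear in `d` at scale `r²`. -/
theorem quadratic_error_le {a d : ℝ} (ha : 0 ≤ a) (hd : 0 ≤ d) (hd1 : d ≤ 1) (r : ℝ) :
    2 * (a * r) * (2 * (d * r * (1 + a))) + (2 * (d * r * (1 + a))) ^ 2
      ≤ 8 * (1 + a) ^ 2 * (d * r ^ 2) := by
  have h1 : 0 ≤ d * r ^ 2 * (1 + a) := by positivity
  have h2 : 0 ≤ d * r ^ 2 * (1 + a) ^ 2 := by positivity
  have h3 : 8 * (1 + a) ^ 2 * (d * r ^ 2)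
      - (2 * (a * r) * (2 * (d * r * (1 + a))) + (2 * (d * r * (1 + a))) ^ 2)
      = 4 * (d * r ^ 2 * (1 + a)) + 4 * ((1 - d) * (d * r ^ 2 * (1 + a) ^ 2)) := by ring
  have h4 := mul_nonneg (sub_nonneg.2 hd1) h2
  linarith

/-- The little-o of the derivative, made uniform over the part of `E` in a ball of radius `c r`. -/
theorem HasFDerivWithinAt.eventually_norm_sub_le {F : W → V} {A : W →L[ℝ] V} {E : Set W} {p : W}
    (hF : HasFDerivWithinAt F A E p) (c : ℝ) {δ : ℝ} (hδ : 0 < δ) :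
    ∀ᶠ r : ℝ in 𝓝[>] 0, ∀ q ∈ E, dist q p ≤ c * r → ‖F q - F p - A (q - p)‖ ≤ δ * r := by
  have h1 : ∀ᶠ q in 𝓝[E] p, ‖F q - F p - A (q - p)‖ ≤ δ / (|c| + 1) * ‖q - p‖ :=
    hF.isLittleO.def (by positivity)
  rw [eventually_nhdsWithin_iff, Metric.eventually_nhds_iff] at h1
  obtain ⟨ρ, hρ, h⟩ := h1
  have h2 : (0 : ℝ) < ρ / (|c| + 1) := by positivity
  filter_upwards [Ioo_mem_nhdsGT h2] with r hr q hq hd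
  have hr0 : 0 < r := hr.1
  have hr1 : (|c| + 1) * r < ρ := by
    rw [mul_comm]; exact (lt_div_iff₀ (by positivity)).1 hr.2
  have hd' : dist q p ≤ (|c| + 1) * r := hd.trans (by gcongr; linarith [le_abs_self c])
  refine (h (hd'.trans_lt hr1) hq).trans ?_
  rw [← dist_eq_norm, div_mul_eq_mul_div, div_le_iff₀ (by positivity)]
  calc δ * dist q p ≤ δ * ((|c| + 1) * r) := by gcongr
    _ = _ := by ring

variable {ω : V →L[ℝ] V →L[ℝ] ℝ} {F : W → V} {τ : W → ℝ} {A : W →L[ℝ] V} {E : Set W} {p : W}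
  {L : ℝ}

/-- At a point of asymptotic density where `F` is differentiable, the contact defect is of second
order: `τ` has no vertical component in the limit. -/
theorem eventually_abs_contactDefect_le (hω : ∀ v, ω v v = 0)
    (hτ : ∀ q ∈ E, ∀ q' ∈ E, |contactDefect ω F τ q q'| ≤ L * dist q q' ^ 2) (hL : 0 ≤ L)
    (hp : p ∈ E) (hE : AsymptoticallyDenseAt E p) (hF : HasFDerivWithinAt F A E p)
    {ε : ℝ} (hε : 0 < ε) :
    ∀ᶠ r : ℝ in 𝓝[>] 0, ∀ q ∈ E, dist q p ≤ r → |contactDefect ω F τ p q| ≤ ε * r ^ 2 := by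
  -- Each step of the chain costs at most `K δ r²`: `9 L` comes from the quadratic estimate, the
  -- other term from the bilinear error.
  set K : ℝ := 9 * L + ‖ω‖ * (8 * (1 + ‖A‖) ^ 2) with hK
  have hK0 : 0 ≤ K := by positivity
  obtain ⟨N, hN⟩ := exists_nat_gt (2 * K / ε)
  have hNpos : (0 : ℝ) < N := lt_of_le_of_lt (by positivity) hN
  have hN1 : (1 : ℝ) ≤ N := by
    have : 0 < N := by exact_mod_cast hNpos
    exact_mod_cast this
  -- With precision `1 / N²`, the sum of `N + 1` such costs is `O(r² / N)`.
  set δ : ℝ := 1 / N ^ 2 with hδ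
  have hδ0 : 0 < δ := by positivity
  have hδN : δ ≤ 1 / N := by
    rw [hδ]
    exact one_div_le_one_div_of_le hNpos (by nlinarith)
  have hN1' : 1 / (N : ℝ) ≤ 1 := (div_le_one hNpos).2 hN1
  have hδ1 : δ ≤ 1 := hδN.trans hN1'
  filter_upwards [hE δ hδ0, hF.eventually_norm_sub_le 2 hδ0, self_mem_nhdsWithin]
    with r hdense hdiff hr q hq hqr
  have hr0 : 0 < r := hr
  set w : ℕ → W := fun j => p + ((j : ℝ) / N) • (q - p) with hw
  set a : V := A (q - p) with ha
  have ha' : ‖a‖ ≤ ‖A‖ * r := by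
    refine (A.le_opNorm _).trans ?_
    rw [← dist_eq_norm]
    gcongr
  have hwp : ∀ j : ℕ, j ≤ N → dist (w j) p ≤ r := by
    intro j hj
    have : (j : ℝ) / N ≤ 1 := (div_le_one hNpos).2 (by exact_mod_cast hj)
    simp only [hw, dist_eq_norm, add_sub_cancel_left, norm_smul, Real.norm_eq_abs]
    rw [abs_of_nonneg (by positivity), ← dist_eq_norm]
    calc (j : ℝ) / N * dist q p ≤ 1 * r := by gcongr
      _ = r := one_mul r
  have herr : ∀ j : ℕ, j ≤ N → ∀ q' ∈ E, dist q' (w j) ≤ δ * r →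
      ‖F q' - F p - ((j : ℝ) / N) • a‖ ≤ δ * r * (1 + ‖A‖) := by
    intro j hj q' hq' hd
    have h1 : dist q' p ≤ 2 * r := by
      have := dist_triangle q' (w j) p
      have := hwp j hj
      nlinarith
    have h2 : A (q' - p) - ((j : ℝ) / N) • a = A (q' - w j) := by
      rw [ha, ← map_smul, ← map_sub]
      congr 1
      simp only [hw]
      abel
    have h3 : F q' - F p - ((j : ℝ) / N) • a
        = (F q' - F p - A (q' - p)) + A (q' - w j) := by
      rw [← h2]; abel
    rw [h3]
    calc _ ≤ ‖F q' - F p - A (q' - p)‖ + ‖A (q' - w j)‖ := norm_add_le _ _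
      _ ≤ δ * r + ‖A‖ * (δ * r) := by
        refine add_le_add (hdiff q' hq' h1) ((A.le_opNorm _).trans ?_)
        rw [← dist_eq_norm]
        gcongr
      _ = _ := by ring
  -- The points `w j` of the segment need not lie in `E`, so the induction runs over all points of
  -- `E` within `δ r` of `w j`.
  have main : ∀ j : ℕ, j ≤ N → ∀ q' ∈ E, dist q' (w j) ≤ δ * r →
      |contactDefect ω F τ p q'| ≤ (j + 1) * (K * (δ * r ^ 2)) := by
    intro j
    induction j with
    | zero =>
      intro _ q' hq' hd
      simp only [hw, Nat.cast_zero, zero_div, zero_smul, add_zero] at hd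
      refine (hτ p hp q' hq').trans ?_
      rw [dist_comm]
      calc L * dist q' p ^ 2 ≤ L * (δ * r) ^ 2 := by gcongr
        _ = L * (δ * (δ * r ^ 2)) := by ring
        _ ≤ K * (1 * (δ * r ^ 2)) := by
          gcongr
          rw [hK]
          have : 0 ≤ ‖ω‖ * (8 * (1 + ‖A‖) ^ 2) := by positivity
          linarith
        _ = _ := by push_cast; ring
    | succ j ih =>
      intro hj q' hq' hd
      have hj' : j ≤ N := (Nat.le_succ j).trans hj
      obtain ⟨q₀, hq₀, hd₀⟩ := hdense (w j) (hwp j hj')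
      have h1 := ih hj' q₀ hq₀ hd₀
      have hwj : dist (w j) (w (j + 1)) ≤ 1 / N * r := by
        have : w j - w (j + 1) = -((1 / (N : ℝ)) • (q - p)) := by
          simp only [hw]
          push_cast
          rw [add_div, add_smul]
          abel
        rw [dist_eq_norm, this, norm_neg, norm_smul, Real.norm_eq_abs,
          abs_of_nonneg (by positivity), ← dist_eq_norm]
        gcongr
      -- One step of length `r / N` and two approximation errors `δ r ≤ r / N`.
      have hdq : dist q₀ q' ≤ 3 * (1 / N * r) := by
        have h2 := dist_triangle4 q₀ (w j) (w (j + 1)) q'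
        rw [dist_comm (w (j + 1))] at h2
        have h3 : δ * r ≤ 1 / N * r := by gcongr
        linarith
      have h2 : |contactDefect ω F τ q₀ q'| ≤ 9 * L * (δ * r ^ 2) := by
        refine (hτ _ hq₀ _ hq').trans ?_
        calc L * dist q₀ q' ^ 2 ≤ L * (3 * (1 / N * r)) ^ 2 := by gcongr
          _ = _ := by rw [hδ]; ring
      -- Both arguments are close to multiples of the same vector `a`, and `ω a a = 0`.
      have h3 : |ω (F q₀ - F p) (F q' - F q₀)| ≤ ‖ω‖ * (8 * (1 + ‖A‖) ^ 2) * (δ * r ^ 2) := by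
        have e1 := herr j hj' q₀ hq₀ hd₀
        have e2 := herr (j + 1) hj q' hq' hd
        have hη : 0 ≤ δ * r * (1 + ‖A‖) := by positivity
        have e3 : ‖F q' - F q₀ - (1 / (N : ℝ)) • a‖ ≤ 2 * (δ * r * (1 + ‖A‖)) := by
          have : F q' - F q₀ - (1 / (N : ℝ)) • a
              = (F q' - F p - (((j + 1 : ℕ) : ℝ) / N) • a)
                - (F q₀ - F p - ((j : ℝ) / N) • a) := by
            push_cast
            rw [add_div, add_smul]
            abel
          rw [this]
          linarith [norm_sub_le (F q' - F p - (((j + 1 : ℕ) : ℝ) / N) • a)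
            (F q₀ - F p - ((j : ℝ) / N) • a)]
        have hsm : ∀ c : ℝ, 0 ≤ c → c ≤ 1 → ‖c • a‖ ≤ ‖A‖ * r := by
          intro c hc hc1
          rw [norm_smul, Real.norm_eq_abs, abs_of_nonneg hc]
          calc c * ‖a‖ ≤ 1 * (‖A‖ * r) := by gcongr
            _ = _ := one_mul _
        have h4 := abs_bilin_sub_le ω
          (hsm ((j : ℝ) / N) (by positivity) ((div_le_one hNpos).2 (by exact_mod_cast hj')))
          (hsm (1 / (N : ℝ)) (by positivity) hN1') (e1.trans (by linarith)) e3
        have h5 : ω (((j : ℝ) / N) • a) ((1 / (N : ℝ)) • a) = 0 := by simp [hω]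
        rw [h5, sub_zero] at h4
        refine h4.trans ?_
        rw [mul_assoc ‖ω‖ (8 * _)]
        refine mul_le_mul_of_nonneg_left ?_ (norm_nonneg ω)
        exact quadratic_error_le (norm_nonneg A) hδ0.le hδ1 r
      rw [contactDefect_add ω hω F τ p q₀ q']
      refine (abs_add_three _ _ _).trans ((add_le_add (add_le_add h1 h2) h3).trans (le_of_eq ?_))
      rw [hK]
      push_cast
      ring
  have hend : w N = q := by
    simp only [hw, div_self hNpos.ne', one_smul]
    abel
  refine (main N le_rfl q hq (by rw [hend, dist_self]; positivity)).trans ?_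
  have h6 : ((N : ℝ) + 1) * K * δ ≤ ε := by
    have h7 : 2 * K < ε * N := by rwa [div_lt_iff₀' hε] at hN
    calc ((N : ℝ) + 1) * K * δ ≤ (N + N) * K * δ := by gcongr
      _ = 2 * K / N := by rw [hδ]; field_simp; ring
      _ ≤ ε := by rw [div_le_iff₀ hNpos]; exact h7.le
  calc _ = ((N : ℝ) + 1) * K * δ * r ^ 2 := by ring
    _ ≤ _ := by gcongr

/-- Take `q ≈ p + r v` and `q' ≈ p + r (v + s w)` in `E`. The three defects among `p`, `q`, `q'` are
all `O(s² r²)`, hence so is the cocycle term of `contactDefect_add`, which is `r² s ω(A v, A w)` up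
to the same order. Dividing by `r² s` and letting `s` tend to `0` gives the claim. -/
theorem bilin_fderivWithin_eq_zero_of_norm_le (hω : ∀ v, ω v v = 0)
    (hτ : ∀ q ∈ E, ∀ q' ∈ E, |contactDefect ω F τ q q'| ≤ L * dist q q' ^ 2) (hL : 0 ≤ L)
    (hp : p ∈ E) (hE : AsymptoticallyDenseAt E p) (hF : HasFDerivWithinAt F A E p)
    {v w : W} (hv : ‖v‖ ≤ 1 / 4) (hw : ‖w‖ ≤ 1 / 4) : ω (A v) (A w) = 0 := by
  set C : ℝ := 2 + 4 * L + ‖ω‖ * (8 * (1 + ‖A‖) ^ 2) with hC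
  have hC0 : 0 < C := by positivity
  have hA := norm_nonneg A
  have key : ∀ s : ℝ, 0 < s → s ≤ 1 / 2 → |ω (A v) (A w)| ≤ C * s := by
    intro s hs0 hs
    have hs2 : 0 < s ^ 2 := by positivity
    have hs3 : s ^ 2 ≤ 1 / 4 := by nlinarith
    obtain ⟨r, hdense, hdiff, hdef, hr⟩ := ((hE _ hs2).and ((hF.eventually_norm_sub_le 1 hs2).and
      ((eventually_abs_contactDefect_le hω hτ hL hp hE hF hs2).and self_mem_nhdsWithin))).exists
    have hr0 : 0 < r := hr
    -- The bound `3 / 4` leaves room for the approximation error `s² r ≤ r / 4` inside the ball of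
    -- radius `r`.
    have approx : ∀ x : W, ‖x‖ ≤ 3 / 4 → ∃ q ∈ E, dist q (p + r • x) ≤ s ^ 2 * r ∧ dist q p ≤ r ∧
        ‖F q - F p - r • A x‖ ≤ s ^ 2 * r * (1 + ‖A‖) := by
      intro x hx
      have hxp : dist (p + r • x) p ≤ 3 / 4 * r := by
        rw [dist_eq_norm, add_sub_cancel_left, norm_smul, Real.norm_eq_abs, abs_of_pos hr0,
          mul_comm]
        gcongr
      obtain ⟨q, hq, hqx⟩ := hdense (p + r • x) (hxp.trans (by linarith))
      have hqp : dist q p ≤ r := by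
        have := dist_triangle q (p + r • x) p
        nlinarith
      refine ⟨q, hq, hqx, hqp, ?_⟩
      have e : F q - F p - r • A x = (F q - F p - A (q - p)) + A (q - (p + r • x)) := by
        simp only [map_sub, map_add, map_smul]
        abel
      rw [e]
      calc _ ≤ ‖F q - F p - A (q - p)‖ + ‖A (q - (p + r • x))‖ := norm_add_le _ _
        _ ≤ s ^ 2 * r + ‖A‖ * (s ^ 2 * r) := by
          refine add_le_add (hdiff q hq (by rwa [one_mul])) ((A.le_opNorm _).trans ?_)
          rw [← dist_eq_norm]
          gcongr
        _ = _ := by ring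
    have hsw : ‖s • w‖ ≤ s * (1 / 4) := by
      rw [norm_smul, Real.norm_eq_abs, abs_of_pos hs0]
      gcongr
    obtain ⟨q, hq, hqx, hqp, hqF⟩ := approx v (by linarith)
    obtain ⟨q', hq', hqx', hqp', hqF'⟩ := approx (v + s • w) (by
      linarith [norm_add_le v (s • w)])
    have hdq : dist q q' ≤ 2 * s * r := by
      have h1 := dist_triangle4 q (p + r • v) (p + r • (v + s • w)) q'
      have h2 : dist (p + r • v) (p + r • (v + s • w)) ≤ s * (1 / 4) * r := by
        rw [dist_comm, dist_eq_norm, smul_add, ← add_assoc, add_sub_cancel_left, norm_smul,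
          Real.norm_eq_abs, abs_of_pos hr0, mul_comm]
        gcongr
      rw [dist_comm (p + r • (v + s • w))] at h1
      have h3 : s ^ 2 * r ≤ 1 / 2 * s * r := by
        gcongr
        nlinarith
      nlinarith [mul_pos hs0 hr0]
    have h1 : |contactDefect ω F τ q q'| ≤ 4 * L * (s ^ 2 * r ^ 2) := by
      refine (hτ q hq q' hq').trans ?_
      calc L * dist q q' ^ 2 ≤ L * (2 * s * r) ^ 2 := by gcongr
        _ = _ := by ring
    have h2 := hdef q hq hqp
    have h3 := hdef q' hq' hqp'
    have h4 : |ω (F q - F p) (F q' - F q)| ≤ (2 + 4 * L) * (s ^ 2 * r ^ 2) := by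
      have e : ω (F q - F p) (F q' - F q) = contactDefect ω F τ p q' - contactDefect ω F τ p q
          - contactDefect ω F τ q q' := by
        rw [contactDefect_add ω hω F τ p q q']
        ring
      rw [e]
      linarith [abs_sub (contactDefect ω F τ p q' - contactDefect ω F τ p q)
        (contactDefect ω F τ q q'), abs_sub (contactDefect ω F τ p q') (contactDefect ω F τ p q)]
    have hη : 0 ≤ s ^ 2 * r * (1 + ‖A‖) := by positivity
    have hqq : ‖F q' - F q - r • A (s • w)‖ ≤ 2 * (s ^ 2 * r * (1 + ‖A‖)) := by
      have e : F q' - F q - r • A (s • w)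
          = (F q' - F p - r • A (v + s • w)) - (F q - F p - r • A v) := by
        rw [map_add, smul_add]
        abel
      rw [e]
      linarith [norm_sub_le (F q' - F p - r • A (v + s • w)) (F q - F p - r • A v)]
    have hnorm : ∀ x : W, ‖x‖ ≤ 1 → ‖r • A x‖ ≤ ‖A‖ * r := by
      intro x hx
      rw [norm_smul, Real.norm_eq_abs, abs_of_pos hr0, mul_comm]
      gcongr
      exact A.le_of_opNorm_le_of_le le_rfl hx |>.trans (by simp)
    have h5 := abs_bilin_sub_le ω (hnorm v (by linarith)) (hnorm (s • w) (by linarith))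
      (hqF.trans (by linarith)) hqq
    have h6 : ‖ω‖ * (2 * (‖A‖ * r) * (2 * (s ^ 2 * r * (1 + ‖A‖)))
        + (2 * (s ^ 2 * r * (1 + ‖A‖))) ^ 2) ≤ ‖ω‖ * (8 * (1 + ‖A‖) ^ 2) * (s ^ 2 * r ^ 2) := by
      rw [mul_assoc ‖ω‖ (8 * _)]
      refine mul_le_mul_of_nonneg_left ?_ (norm_nonneg ω)
      exact quadratic_error_le hA hs2.le (by linarith) r
    have h7 : ω (r • A v) (r • A (s • w)) = r ^ 2 * s * ω (A v) (A w) := by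
      simp only [map_smul, _root_.smul_apply, smul_eq_mul]
      ring
    have h8 : |r ^ 2 * s * ω (A v) (A w)| ≤ C * (s ^ 2 * r ^ 2) := by
      rw [← h7, hC, add_mul]
      have g := abs_sub_abs_le_abs_sub (ω (r • A v) (r • A (s • w))) (ω (F q - F p) (F q' - F q))
      rw [abs_sub_comm] at g
      linarith
    rw [abs_mul, abs_of_pos (by positivity : 0 < r ^ 2 * s)] at h8
    refine le_of_mul_le_mul_left ?_ (by positivity : 0 < r ^ 2 * s)
    linarith
  by_contra hne
  have hpos : 0 < |ω (A v) (A w)| := abs_pos.2 hne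
  -- This `s` makes `C * s` at most half of the positive quantity that it should bound.
  have h1 := key (min (1 / 2) (|ω (A v) (A w)| / (2 * C))) (by positivity) (min_le_left _ _)
  have h2 : C * min (1 / 2) (|ω (A v) (A w)| / (2 * C)) ≤ C * (|ω (A v) (A w)| / (2 * C)) := by
    gcongr
    exact min_le_right _ _
  have h3 : C * (|ω (A v) (A w)| / (2 * C)) = |ω (A v) (A w)| / 2 := by field_simp
  linarith

/-- The derivative of `F` at a point of asymptotic density has isotropic range. -/
theorem bilin_fderivWithin_eq_zero (hω : ∀ v, ω v v = 0)
    (hτ : ∀ q ∈ E, ∀ q' ∈ E, |contactDefect ω F τ q q'| ≤ L * dist q q' ^ 2) (hL : 0 ≤ L)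
    (hp : p ∈ E) (hE : AsymptoticallyDenseAt E p) (hF : HasFDerivWithinAt F A E p)
    (v w : W) : ω (A v) (A w) = 0 := by
  -- By bilinearity it suffices to treat small multiples of `v` and `w`.
  set c : ℝ := 1 / (4 * (‖v‖ + ‖w‖ + 1)) with hc
  have hc0 : 0 < c := by positivity
  have hle : ∀ x : W, ‖x‖ ≤ ‖v‖ + ‖w‖ + 1 → ‖c • x‖ ≤ 1 / 4 := by
    intro x hx
    rw [norm_smul, Real.norm_eq_abs, abs_of_pos hc0]
    calc c * ‖x‖ ≤ c * (‖v‖ + ‖w‖ + 1) := by gcongr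
      _ = 1 / 4 := by rw [hc]; field_simp
  have h := bilin_fderivWithin_eq_zero_of_norm_le hω hτ hL hp hE hF
    (hle v (by linarith [norm_nonneg w])) (hle w (by linarith [norm_nonneg v]))
  simpa [hc0.ne'] using h

/-- Near a point of asymptotic density the pair `(F, τ)` is, up to errors of lower order,
horizontal and as expanding as the derivative of `F`. -/
theorem eventually_norm_sub_le_and_abs_contactDefect_le (hω : ∀ v, ω v v = 0)
    (hτ : ∀ q ∈ E, ∀ q' ∈ E, |contactDefect ω F τ q q'| ≤ L * dist q q' ^ 2) (hL : 0 ≤ L)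
    (hp : p ∈ E) (hE : AsymptoticallyDenseAt E p) (hF : HasFDerivWithinAt F A E p)
    {ε : ℝ} (hε : 0 < ε) :
    ∀ᶠ r : ℝ in 𝓝[>] 0, ∀ q ∈ E, dist q p ≤ r → ∀ q' ∈ E, dist q' p ≤ r →
      ‖F q' - F q‖ ≤ ‖A (q' - q)‖ + ε * r ∧ |contactDefect ω F τ q q'| ≤ (ε * r) ^ 2 := by
  set K : ℝ := 2 + ‖ω‖ * (8 * ‖A‖ + 4) with hK
  have hK0 : 0 < K := by positivity
  -- `ε / 2` serves the estimate of `F`, whose error is `2 δ r`; `ε² / K` serves the defect, and `δ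
  -- ≤ 1` absorbs its term in `δ²`.
  set δ : ℝ := min (min 1 (ε / 2)) (ε ^ 2 / K) with hδ
  have hδ0 : 0 < δ := by positivity
  have hδ1 : δ ≤ 1 := (min_le_left _ _).trans (min_le_left _ _)
  have hδ2 : δ ≤ ε / 2 := (min_le_left _ _).trans (min_le_right _ _)
  have hδ3 : K * δ ≤ ε ^ 2 := by
    rw [mul_comm]
    exact (le_div_iff₀ hK0).1 (min_le_right _ _)
  filter_upwards [hF.eventually_norm_sub_le 1 hδ0,
    eventually_abs_contactDefect_le hω hτ hL hp hE hF hδ0, self_mem_nhdsWithin]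
    with r hdiff hdef hr q hq hqp q' hq' hqp'
  have hr0 : 0 < r := hr
  have h1 := hdiff q hq (by rwa [one_mul])
  have h2 := hdiff q' hq' (by rwa [one_mul])
  have h3 : ‖F q' - F q - A (q' - q)‖ ≤ 2 * δ * r := by
    have e : F q' - F q - A (q' - q) = (F q' - F p - A (q' - p)) - (F q - F p - A (q - p)) := by
      simp only [map_sub]
      abel
    rw [e]
    linarith [norm_sub_le (F q' - F p - A (q' - p)) (F q - F p - A (q - p))]
  constructor
  · have h4 := norm_sub_norm_le (F q' - F q) (A (q' - q))
    nlinarith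
  · have hA := norm_nonneg A
    have n1 : ‖A (q - p)‖ ≤ 2 * ‖A‖ * r := by
      refine (A.le_opNorm _).trans ?_
      rw [← dist_eq_norm]
      calc ‖A‖ * dist q p ≤ ‖A‖ * r := by gcongr
        _ ≤ 2 * ‖A‖ * r := by nlinarith [mul_nonneg hA hr0.le]
    have n2 : ‖A (q' - q)‖ ≤ 2 * ‖A‖ * r := by
      refine (A.le_opNorm _).trans ?_
      rw [← dist_eq_norm]
      calc ‖A‖ * dist q' q ≤ ‖A‖ * (r + r) := by
            gcongr
            linarith [dist_triangle_right q' q p]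
        _ = 2 * ‖A‖ * r := by ring
    have h4 := abs_bilin_sub_le ω n1 n2 (h1.trans (by nlinarith)) h3
    -- Isotropy removes the main term `ω(A(q - p), A(q' - q))`, which would otherwise be of order
    -- `r²`.
    rw [bilin_fderivWithin_eq_zero hω hτ hL hp hE hF, sub_zero] at h4
    have h5 : ‖ω‖ * (2 * (2 * ‖A‖ * r) * (2 * δ * r) + (2 * δ * r) ^ 2)
        ≤ ‖ω‖ * (8 * ‖A‖ + 4) * δ * r ^ 2 := by
      have : δ * (δ * r ^ 2) ≤ 1 * (δ * r ^ 2) := by gcongr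
      rw [mul_assoc ‖ω‖, mul_assoc ‖ω‖]
      refine mul_le_mul_of_nonneg_left ?_ (norm_nonneg ω)
      nlinarith
    have e : contactDefect ω F τ q q' = contactDefect ω F τ p q' - contactDefect ω F τ p q
        - ω (F q - F p) (F q' - F q) := by
      rw [contactDefect_add ω hω F τ p q q']
      ring
    have h6 := hdef q hq hqp
    have h7 := hdef q' hq' hqp'
    rw [e]
    calc _ ≤ δ * r ^ 2 + δ * r ^ 2 + ‖ω‖ * (8 * ‖A‖ + 4) * δ * r ^ 2 := by
          linarith [abs_sub (contactDefect ω F τ p q' - contactDefect ω F τ p q)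
            (ω (F q - F p) (F q' - F q)),
            abs_sub (contactDefect ω F τ p q') (contactDefect ω F τ p q)]
      _ = K * δ * r ^ 2 := by rw [hK]; ring
      _ ≤ ε ^ 2 * r ^ 2 := by gcongr
      _ = _ := by ring

end Contact

/-! ### Density points, covers of images of small balls, and Hausdorff null images. -/

section Covering

/-- The image under `f` of the part of `E` in a small ball around `p` has finite covers for which
the sum of the `d`-th powers of the diameters is much smaller than `r ^ d`. -/
def HasSmallCovers {W X : Type*} [PseudoMetricSpace W] [EMetricSpace X] (f : W → X)
    (E : Set W) (d : ℕ) (p : W) : Prop :=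
  ∀ ε > 0, ∀ᶠ r : ℝ in 𝓝[>] 0, ∃ (ι : Type) (_ : Fintype ι) (S : ι → Set X),
    f '' (E ∩ Metric.closedBall p r) ⊆ ⋃ i, S i ∧ (∀ i, Metric.ediam (S i) ≤ ENNReal.ofReal r) ∧
      ∑ i, Metric.ediam (S i) ^ d ≤ ENNReal.ofReal (ε * r ^ d)

theorem HasSmallCovers.mono {W X : Type*} [PseudoMetricSpace W] [EMetricSpace X] {f : W → X}
    {E E' : Set W} {d : ℕ} {p : W} (h : HasSmallCovers f E d p) (hE : E' ⊆ E) : HasSmallCovers f E' d p := by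
  intro ε hε
  filter_upwards [h ε hε] with r ⟨ι, hι, S, h1, h2⟩
  exact ⟨ι, hι, S, (image_mono (inter_subset_inter_left _ hE)).trans h1, h2⟩

variable {W : Type*} [NormedAddCommGroup W] [NormedSpace ℝ W] [FiniteDimensional ℝ W]

/-- By Lebesgue's density theorem, a set is asymptotically dense at almost all of its points. -/
theorem ae_asymptoticallyDenseAt [MeasurableSpace W] [BorelSpace W] (μ : Measure W)
    [μ.IsAddHaarMeasure] (E : Set W) : ∀ᵐ x ∂μ, x ∈ E → AsymptoticallyDenseAt E x := by
  refine ae_imp_of_ae_restrict ?_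
  filter_upwards [ae_all_iff.2 fun n : ℕ =>
    IsUnifLocDoublingMeasure.ae_tendsto_measure_inter_div.{_, 0} μ E (n : ℝ)] with x hx δ hδ
  obtain ⟨n, hn⟩ := exists_nat_ge (1 / δ)
  have hn' : 1 ≤ n * δ := by rwa [div_le_iff₀ hδ] at hn
  -- At each scale, `w` is a point violating the density condition if there is one; ruling it out at
  -- `w` settles every point.
  have hbad : ∀ r : ℝ, ∃ w, 0 ≤ r → dist w x ≤ r ∧
      ((∃ q ∈ E, dist q w ≤ δ * r) → ∀ w, dist w x ≤ r → ∃ q ∈ E, dist q w ≤ δ * r) := by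
    intro r
    by_cases h : ∀ w, dist w x ≤ r → ∃ q ∈ E, dist q w ≤ δ * r
    · exact ⟨x, fun hr => ⟨by simpa using hr, fun _ => h⟩⟩
    · push Not at h
      obtain ⟨w, hw, hw'⟩ := h
      exact ⟨w, fun _ => ⟨hw, fun ⟨q, hq, hq'⟩ => absurd (hw' q hq) (not_lt.2 hq')⟩⟩
  choose w hw using hbad
  have hlim : Tendsto (fun r : ℝ => δ * r) (𝓝[>] 0) (𝓝[>] 0) := by
    refine tendsto_nhdsWithin_iff.2 ⟨?_, ?_⟩
    · have : Tendsto (fun r : ℝ => δ * r) (𝓝 0) (𝓝 (δ * 0)) := tendsto_id.const_mul δ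
      rw [mul_zero] at this
      exact this.mono_left nhdsWithin_le_nhds
    · filter_upwards [self_mem_nhdsWithin] with r hr
      exact mul_pos hδ hr
  -- The density theorem is applied to the balls of radius `δ r` about `w r`. They need not be
  -- centred at `x`, but `n ≥ 1 / δ` puts `x` in their `n`-fold enlargements.
  have h1 := hx n w (fun r => δ * r) hlim (by
    filter_upwards [self_mem_nhdsWithin] with r hr
    have hr0 : (0 : ℝ) < r := hr
    rw [Metric.mem_closedBall, dist_comm, ← mul_assoc]
    exact (hw r hr0.le).1.trans (le_mul_of_one_le_left hr0.le hn'))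
  filter_upwards [h1.eventually (lt_mem_nhds zero_lt_one), self_mem_nhdsWithin] with r hr hr0
  refine (hw r (le_of_lt hr0)).2 ?_
  by_contra hcon
  have hempty : E ∩ Metric.closedBall (w r) (δ * r) = ∅ := by
    refine eq_empty_of_forall_notMem fun q hq => hcon ⟨q, hq.1, hq.2⟩
  rw [hempty] at hr
  simp at hr

/-- A map that, at small scales around `p`, expands distances at most as much as a linear map of
rank smaller than `d` has small `d`-dimensional covers. -/
theorem hasSmallCovers_of_rank_lt {V X : Type*} [NormedAddCommGroup V] [NormedSpace ℝ V]
    [EMetricSpace X] {f : W → X} {E : Set W} {p : W} {d : ℕ} {A : W →L[ℝ] V}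
    (hA : Module.finrank ℝ (LinearMap.range A.toLinearMap) < d) {C : ℝ} (hC : 0 ≤ C)
    (hf : ∀ ε > 0, ∀ᶠ r : ℝ in 𝓝[>] 0, ∀ q ∈ E, dist q p ≤ r → ∀ q' ∈ E, dist q' p ≤ r →
      edist (f q) (f q') ≤ ENNReal.ofReal (C * (‖A (q' - q)‖ + ε * r))) :
    HasSmallCovers f E d p := by
  set j := Module.finrank ℝ (LinearMap.range A.toLinearMap) with hj
  let e : LinearMap.range A.toLinearMap ≃L[ℝ] (Fin j → ℝ) :=
    ContinuousLinearEquiv.ofFinrankEq (by simp [hj])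
  -- `M` is `A` followed by linear coordinates on its range, so a grid in `ℝ^j` controls `A`.
  let M : W →L[ℝ] (Fin j → ℝ) :=
    (e : LinearMap.range A.toLinearMap →L[ℝ] (Fin j → ℝ)).comp
      (LinearMap.toContinuousLinearMap A.toLinearMap.rangeRestrict)
  obtain ⟨c₁, hc₁, hAM⟩ : ∃ c₁ : ℝ, 0 ≤ c₁ ∧ ∀ x, ‖A x‖ ≤ c₁ * ‖M x‖ := by
    refine ⟨‖(e.symm : (Fin j → ℝ) →L[ℝ] LinearMap.range A.toLinearMap)‖,
      ContinuousLinearMap.opNorm_nonneg _, ?_⟩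
    intro x
    have h1 : ((e.symm (M x) : LinearMap.range A.toLinearMap) : V) = A x := by
      simp [M]
    rw [← h1]
    exact (e.symm : (Fin j → ℝ) →L[ℝ] LinearMap.range A.toLinearMap).le_opNorm (M x)
  set c : ℝ := ‖M‖ + 1 with hc
  have hc0 : 0 < c := by positivity
  set D : ℝ := C * (c₁ * c + 1) with hD
  have hD0 : 0 ≤ D := by positivity
  intro ε hε
  -- The first bound on `m` makes the sum of powers small; the second makes every diameter at most
  -- `r`.
  obtain ⟨m, hm⟩ := exists_nat_gt (max (3 ^ j * D ^ d / ε) D)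
  have hmD : D ≤ m := (le_max_right _ _).trans hm.le
  have hmε : 3 ^ j * D ^ d ≤ ε * m := by
    have := (le_max_left _ _).trans hm.le
    rwa [div_le_iff₀' hε] at this
  have hm0 : (0 : ℝ) < m := lt_of_le_of_lt (hD0.trans (le_max_right _ _)) hm
  have hm1 : (1 : ℝ) ≤ m := by
    have : 0 < m := by exact_mod_cast hm0
    exact_mod_cast this
  filter_upwards [hf (1 / m) (by positivity), self_mem_nhdsWithin] with r hfr hr
  have hr0 : 0 < r := hr
  let I : Finset ℤ := Finset.Icc (-(m : ℤ)) m
  -- The cells are preimages under `M` of grid cubes of side `c r / m`.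
  let S : (Fin j → I) → Set X := fun g =>
    f '' {q | q ∈ E ∩ Metric.closedBall p r ∧ ∀ i, ⌊m / (c * r) * M (q - p) i⌋ = g i}
  have hdiam : ∀ g, Metric.ediam (S g) ≤ ENNReal.ofReal (D / m * r) := by
    intro g
    refine Metric.ediam_le ?_
    rintro _ ⟨q, ⟨⟨hq, hqp⟩, hqg⟩, rfl⟩ _ ⟨q', ⟨⟨hq', hqp'⟩, hqg'⟩, rfl⟩
    refine (hfr q hq hqp q' hq' hqp').trans (ENNReal.ofReal_le_ofReal ?_)
    have h1 : ‖M (q' - q)‖ ≤ c * r / m := by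
      refine (pi_norm_le_iff_of_nonneg (by positivity)).2 fun i => ?_
      have h2 := Int.abs_sub_lt_one_of_floor_eq_floor ((hqg' i).trans (hqg i).symm)
      rw [← mul_sub, ← Pi.sub_apply, ← map_sub, sub_sub_sub_cancel_right, abs_mul,
        abs_of_pos (by positivity)] at h2
      rw [Real.norm_eq_abs, le_div_iff₀ hm0]
      rw [div_mul_eq_mul_div, div_lt_one (by positivity)] at h2
      linarith
    calc C * (‖A (q' - q)‖ + 1 / m * r) ≤ C * (c₁ * (c * r / m) + 1 / m * r) := by
          gcongr
          exact (hAM _).trans (by gcongr)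
      _ = D / m * r := by rw [hD]; ring
  refine ⟨Fin j → I, inferInstance, S, ?_, ?_, ?_⟩
  · rintro _ ⟨q, hq, rfl⟩
    have hmem : ∀ i, ⌊m / (c * r) * M (q - p) i⌋ ∈ I := by
      intro i
      have h1 : |M (q - p) i| ≤ c * r := by
        refine (norm_le_pi_norm (M (q - p)) i).trans ((M.le_opNorm _).trans ?_)
        have h2 : ‖q - p‖ ≤ r := by rw [← dist_eq_norm]; exact hq.2
        gcongr
        linarith
      have h3 : |m / (c * r) * M (q - p) i| ≤ m := by
        rw [abs_mul, abs_of_pos (by positivity), div_mul_eq_mul_div,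
          div_le_iff₀ (by positivity)]
        gcongr
      rw [abs_le] at h3
      refine Finset.mem_Icc.2 ⟨Int.le_floor.2 (by push_cast; exact h3.1), ?_⟩
      have := (Int.floor_le (m / (c * r) * M (q - p) i)).trans h3.2
      exact_mod_cast this
    exact mem_iUnion.2 ⟨fun i => ⟨_, hmem i⟩, q, ⟨hq, fun i => rfl⟩, rfl⟩
  · intro g
    refine (hdiam g).trans (ENNReal.ofReal_le_ofReal ?_)
    exact mul_le_of_le_one_left hr0.le ((div_le_one hm0).2 hmD)
  · have hcard : ((Finset.univ : Finset (Fin j → I)).card : ℝ) = (2 * m + 1) ^ j := by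
      rw [Finset.card_univ, Fintype.card_fun, Fintype.card_coe, Fintype.card_fin, Int.card_Icc]
      have : ((m : ℤ) + 1 - -(m : ℤ)).toNat = 2 * m + 1 := by omega
      rw [this]
      push_cast
      rfl
    calc ∑ g, Metric.ediam (S g) ^ d ≤ ∑ g : Fin j → I, ENNReal.ofReal (D / m * r) ^ d :=
          Finset.sum_le_sum fun g _ => by gcongr; exact hdiam g
      _ = ENNReal.ofReal ((2 * m + 1) ^ j * (D / m * r) ^ d) := by
        rw [Finset.sum_const, nsmul_eq_mul, ← hcard, ENNReal.ofReal_mul (Nat.cast_nonneg _),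
          ENNReal.ofReal_natCast, ENNReal.ofReal_pow (by positivity)]
      _ ≤ ENNReal.ofReal (ε * r ^ d) := by
        refine ENNReal.ofReal_le_ofReal ?_
        have h1 : (2 * (m : ℝ) + 1) ^ j ≤ 3 ^ j * m ^ j := by
          rw [← mul_pow]
          gcongr
          linarith
        -- The rank deficit `j + 1 ≤ d` supplies the spare factor `m`, which beats the constants.
        have h2 : (m : ℝ) ^ j * m ≤ m ^ d := by
          rw [← pow_succ]
          exact pow_le_pow_right₀ hm1 hA
        rw [mul_pow, div_pow, ← mul_assoc]
        gcongr
        rw [mul_div_assoc', div_le_iff₀ (by positivity)]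
        calc (2 * (m : ℝ) + 1) ^ j * D ^ d ≤ 3 ^ j * m ^ j * D ^ d := by gcongr
          _ = 3 ^ j * D ^ d * m ^ j := by ring
          _ ≤ ε * m * m ^ j := by gcongr
          _ = ε * (m ^ j * m) := by ring
          _ ≤ ε * m ^ d := by gcongr

/-- For each `m`, disjoint balls of radius less than `1 / (m + 1)` cover almost all of `E`.
Comparison of volumes bounds the sum of `r^d` over these balls independently of `m`, so the small
covers with `ε = 1 / (m + 1)` have total cost tending to `0`. The points missed for some `m` form a
null set, handled by `hnull`. -/
theorem hausdorffMeasure_image_eq_zero_of_isBounded [MeasurableSpace W] [BorelSpace W]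
    (μ : Measure W) [μ.IsAddHaarMeasure] {X : Type*} [EMetricSpace X] [MeasurableSpace X]
    [BorelSpace X] {f : W → X} {E : Set W}
    (hnull : ∀ N ⊆ E, μ N = 0 → Measure.hausdorffMeasure (Module.finrank ℝ W : ℝ) (f '' N) = 0)
    (hE : ∀ p ∈ E, HasSmallCovers f E (Module.finrank ℝ W) p) (hb : Bornology.IsBounded E) :
    Measure.hausdorffMeasure (Module.finrank ℝ W : ℝ) (f '' E) = 0 := by
  set d := Module.finrank ℝ W with hd
  obtain ⟨R, hR⟩ := hb.subset_closedBall (0 : W)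
  have step : ∀ m : ℕ, ∃ (t : Set W) (r : W → ℝ), t.Countable ∧ t ⊆ E ∧
      (∀ x ∈ t, r x ∈ {r : ℝ | ∃ (ι : Type) (_ : Fintype ι) (S : ι → Set X),
        f '' (E ∩ Metric.closedBall x r) ⊆ ⋃ i, S i ∧
        (∀ i, Metric.ediam (S i) ≤ ENNReal.ofReal r) ∧
        ∑ i, Metric.ediam (S i) ^ d ≤ ENNReal.ofReal (1 / (m + 1) * r ^ d)} ∩
          Ioo 0 (1 / (m + 1))) ∧
      μ (E \ ⋃ x ∈ t, Metric.closedBall x (r x)) = 0 ∧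
      t.PairwiseDisjoint fun x => Metric.closedBall x (r x) := by
    intro m
    refine Besicovitch.exists_disjoint_closedBall_covering_ae μ _ E ?_ (fun _ => 1 / (m + 1))
      fun _ _ => by positivity
    intro x hx δ hδ
    exact ((hE x hx (1 / (m + 1)) (by positivity)).and (Ioo_mem_nhdsGT hδ)).exists
  choose t r htc htE htr htμ htd using step
  set N : Set W := ⋃ m, (E \ ⋃ x ∈ t m, Metric.closedBall x (r m x)) with hN
  have hNE : N ⊆ E := iUnion_subset fun m => sdiff_subset
  have hN0 : μ N = 0 := measure_iUnion_null htμ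
  suffices h : Measure.hausdorffMeasure (d : ℝ) (f '' (E \ N)) = 0 by
    have : f '' E = f '' (E \ N) ∪ f '' N := by
      rw [← image_union, sdiff_union_of_subset hNE]
    rw [this]
    exact measure_union_null h (hnull N hNE hN0)
  choose ι hι S hcov hdiam hsum using fun (m : ℕ) (x : t m) => (htr m x x.2).1
  have hpos : ∀ (m : ℕ) (x : t m), 0 < r m x ∧ r m x < 1 / (m + 1) := fun m x => (htr m x x.2).2
  have hcount : ∀ m, Countable (t m) := fun m => (htc m).to_subtype
  set B : ℝ≥0∞ := μ (Metric.ball (0 : W) 1) with hB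
  have hB0 : B ≠ 0 := (Metric.measure_ball_pos μ _ one_pos).ne'
  have hBt : B ≠ ⊤ := measure_ball_lt_top.ne
  set T : ℝ≥0∞ := μ (Metric.closedBall (0 : W) (R + 1)) with hT
  have hTt : T ≠ ⊤ := measure_closedBall_lt_top.ne
  -- The balls are disjoint and lie in the ball of radius `R + 1`, of volume `T`; a ball of radius
  -- `r` has volume `r^d B`.
  have hpow : ∀ m, ∑' x : t m, ENNReal.ofReal (r m x ^ d) ≤ T / B := by
    intro m
    rw [ENNReal.le_div_iff_mul_le (Or.inl hB0) (Or.inl hBt), ← ENNReal.tsum_mul_right]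
    calc ∑' x : t m, ENNReal.ofReal (r m x ^ d) * B
        = ∑' x : t m, μ (Metric.closedBall (x : W) (r m x)) := by
          refine tsum_congr fun x => ?_
          rw [Measure.addHaar_closedBall μ _ (hpos m x).1.le]
      _ = μ (⋃ x ∈ t m, Metric.closedBall x (r m x)) :=
          (measure_biUnion (htc m) (htd m) fun _ _ => Metric.isClosed_closedBall.measurableSet).symm
      _ ≤ T := by
          refine measure_mono (iUnion₂_subset fun x hx => ?_)
          refine Metric.closedBall_subset_closedBall' ?_
          have h1 := hR (htE m hx)
          have h2 := (hpos m ⟨x, hx⟩).2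
          have h3 : 1 / ((m : ℝ) + 1) ≤ 1 := by
            rw [div_le_one (by positivity)]
            linarith [Nat.cast_nonneg (α := ℝ) m]
          rw [Metric.mem_closedBall] at h1
          simp only at h2
          linarith
  have hlim : Tendsto (fun m : ℕ => ENNReal.ofReal (1 / ((m : ℝ) + 1))) atTop (𝓝 0) := by
    have := ENNReal.tendsto_ofReal (tendsto_one_div_add_atTop_nhds_zero_nat (𝕜 := ℝ))
    rwa [ENNReal.ofReal_zero] at this
  refine le_antisymm ?_ zero_le
  refine (Measure.hausdorffMeasure_le_liminf_tsum (ι := fun m => Σ x : t m, ι m x) (d : ℝ) _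
    (l := atTop) _ hlim (fun m i => S m i.1 i.2) (Eventually.of_forall fun m i => ?_)
    (Eventually.of_forall fun m => ?_)).trans ?_
  · exact (hdiam m i.1 i.2).trans (ENNReal.ofReal_le_ofReal (hpos m i.1).2.le)
  · rintro _ ⟨q, ⟨hq, hqN⟩, rfl⟩
    have h1 : q ∈ ⋃ x ∈ t m, Metric.closedBall x (r m x) := by
      by_contra hcon
      exact hqN (mem_iUnion.2 ⟨m, hq, hcon⟩)
    obtain ⟨x, hx, hqx⟩ := mem_iUnion₂.1 h1
    obtain ⟨i, hi⟩ := mem_iUnion.1 (hcov m ⟨x, hx⟩ ⟨q, ⟨hq, hqx⟩, rfl⟩)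
    exact mem_iUnion.2 ⟨⟨⟨x, hx⟩, i⟩, hi⟩
  · have hle : ∀ m : ℕ, ∑' i : (Σ x : t m, ι m x), Metric.ediam (S m i.1 i.2) ^ (d : ℝ)
        ≤ ENNReal.ofReal (1 / ((m : ℝ) + 1)) * (T / B) := by
      intro m
      rw [ENNReal.tsum_sigma']
      calc ∑' x : t m, ∑' i, Metric.ediam (S m x i) ^ (d : ℝ)
          ≤ ∑' x : t m, ENNReal.ofReal (1 / ((m : ℝ) + 1)) * ENNReal.ofReal (r m x ^ d) := by
            refine ENNReal.tsum_le_tsum fun x => ?_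
            rw [tsum_fintype, ← ENNReal.ofReal_mul (by positivity)]
            simp only [ENNReal.rpow_natCast]
            exact hsum m x
        _ ≤ _ := by
            rw [ENNReal.tsum_mul_left]
            gcongr
            exact hpow m
    have hlim' : Tendsto (fun m : ℕ => ENNReal.ofReal (1 / ((m : ℝ) + 1)) * (T / B)) atTop
        (𝓝 0) := by
      have := ENNReal.Tendsto.mul_const hlim (Or.inr (ENNReal.div_ne_top hTt hB0))
      rwa [zero_mul] at this
    exact (liminf_le_liminf (Eventually.of_forall hle)).trans hlim'.liminf_eq.le

/-- A map with small covers at almost every point of `E` that preserves null sets sends `E` to a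
null set for the Hausdorff measure. -/
theorem hausdorffMeasure_image_eq_zero [MeasurableSpace W] [BorelSpace W]
    (μ : Measure W) [μ.IsAddHaarMeasure] {X : Type*} [EMetricSpace X] [MeasurableSpace X]
    [BorelSpace X] {f : W → X} {E : Set W}
    (hnull : ∀ N ⊆ E, μ N = 0 → Measure.hausdorffMeasure (Module.finrank ℝ W : ℝ) (f '' N) = 0)
    (hE : ∀ᵐ p ∂μ, p ∈ E → HasSmallCovers f E (Module.finrank ℝ W) p) :
    Measure.hausdorffMeasure (Module.finrank ℝ W : ℝ) (f '' E) = 0 := by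
  set G : Set W := {p ∈ E | HasSmallCovers f E (Module.finrank ℝ W) p} with hG
  have hGE : G ⊆ E := sep_subset _ _
  have h0 : μ (E \ G) = 0 := by
    refine measure_mono_null (fun p hp => ?_) (ae_iff.1 hE)
    exact fun h => hp.2 ⟨hp.1, h hp.1⟩
  have hsub : f '' E ⊆ f '' (E \ G) ∪ ⋃ m : ℕ, f '' (G ∩ Metric.closedBall 0 m) := by
    rintro _ ⟨q, hq, rfl⟩
    by_cases hqG : q ∈ G
    · obtain ⟨m, hm⟩ := exists_nat_ge (dist q 0)
      exact Or.inr (mem_iUnion.2 ⟨m, q, ⟨hqG, hm⟩, rfl⟩)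
    · exact Or.inl ⟨q, ⟨hq, hqG⟩, rfl⟩
  refine measure_mono_null hsub (measure_union_null (hnull _ sdiff_subset h0)
    (measure_iUnion_null fun m => ?_))
  have hGm : G ∩ Metric.closedBall 0 (m : ℝ) ⊆ E := inter_subset_left.trans hGE
  exact hausdorffMeasure_image_eq_zero_of_isBounded μ
    (fun N hN => hnull N (hN.trans hGm)) (fun p hp => hp.1.2.mono hGm)
    (Metric.isBounded_closedBall.subset inter_subset_right)

end Covering

namespace Heisenberg

variable {n : ℕ}

/-! ### The Korányi metric -/

/-- The horizontal coordinates `(x, y)` of a point. -/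
def horizontalPart (p : Heisenberg n) : (Fin n → ℝ) × (Fin n → ℝ) := (p.x, p.y)

/-- Twice the symplectic form in the group law. -/
noncomputable def symplecticForm (n : ℕ) :
    ((Fin n → ℝ) × (Fin n → ℝ)) →L[ℝ] ((Fin n → ℝ) × (Fin n → ℝ)) →L[ℝ] ℝ :=
  let a (i : Fin n) : ((Fin n → ℝ) × (Fin n → ℝ)) →L[ℝ] ℝ :=
    (ContinuousLinearMap.proj i).comp (ContinuousLinearMap.fst ℝ _ _)
  let b (i : Fin n) : ((Fin n → ℝ) × (Fin n → ℝ)) →L[ℝ] ℝ :=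
    (ContinuousLinearMap.proj i).comp (ContinuousLinearMap.snd ℝ _ _)
  (2 : ℝ) • ∑ i, ((b i).smulRight (a i) - (a i).smulRight (b i))

theorem symplecticForm_apply (v w : (Fin n → ℝ) × (Fin n → ℝ)) :
    symplecticForm n v w = 2 * ∑ i, (v.2 i * w.1 i - v.1 i * w.2 i) := by
  simp [symplecticForm]

theorem symplecticForm_self (v : (Fin n → ℝ) × (Fin n → ℝ)) : symplecticForm n v v = 0 := by
  simp [symplecticForm_apply, mul_comm]

/-- The right-hand side is the `contactDefect` of the coordinates, which links the analysis above to
the group. -/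
theorem inv_mul_t (p q : Heisenberg n) :
    (p⁻¹ * q).t = q.t - p.t - symplecticForm n (horizontalPart p) (horizontalPart q) := by
  have : ∑ i, (p⁻¹.y i * q.x i - p⁻¹.x i * q.y i) = -∑ i, (p.y i * q.x i - p.x i * q.y i) := by
    rw [← Finset.sum_neg_distrib]
    refine Finset.sum_congr rfl fun i _ => ?_
    simp only [inv_x, inv_y, Pi.neg_apply]
    ring
  rw [mul_t, this, symplecticForm_apply, inv_t]
  simp only [horizontalPart]
  ring

theorem horizontalPart_inv_mul (p q : Heisenberg n) :
    horizontalPart (p⁻¹ * q) = horizontalPart q - horizontalPart p := by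
  ext i <;> simp [horizontalPart] <;> ring

/-- An isotropic subspace of the symplectic space `ℝ^{2n}` has dimension at most `n`. -/
theorem finrank_le_of_isotropic (S : Submodule ℝ ((Fin n → ℝ) × (Fin n → ℝ)))
    (hS : ∀ v ∈ S, ∀ w ∈ S, symplecticForm n v w = 0) : Module.finrank ℝ S ≤ n := by
  let B : LinearMap.BilinForm ℝ ((Fin n → ℝ) × (Fin n → ℝ)) :=
    (ContinuousLinearMap.coeLM ℝ).comp (symplecticForm n).toLinearMap
  have hB : ∀ v w, B v w = symplecticForm n v w := fun _ _ => rfl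
  have hker : LinearMap.ker B = ⊥ := by
    refine (Submodule.eq_bot_iff _).2 fun v hv => ?_
    have h : ∀ w, symplecticForm n v w = 0 := fun w => by
      rw [← hB, LinearMap.mem_ker.1 hv]
      rfl
    ext i
    · simpa [symplecticForm_apply, Pi.single_apply] using h (0, Pi.single i 1)
    · simpa [symplecticForm_apply, Pi.single_apply] using h (Pi.single i 1, 0)
  -- By nondegeneracy the dimensions of `S` and its orthogonal add up to `2 n`, and isotropy puts
  -- `S` inside its orthogonal.
  have h1 := LinearMap.BilinForm.finrank_add_finrank_orthogonal' (B := B) S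
  rw [hker, inf_bot_eq, finrank_bot, add_zero] at h1
  have h2 : S ≤ B.orthogonal S := fun w hw v hv => hS v hv w hw
  have h3 := Submodule.finrank_mono h2
  have h4 : Module.finrank ℝ ((Fin n → ℝ) × (Fin n → ℝ)) = n + n := by simp
  omega

theorem koranyiNorm_nonneg (p : Heisenberg n) : 0 ≤ koranyiNorm p := by
  rw [koranyiNorm_eq]
  exact Real.sqrt_nonneg _

theorem koranyiNorm_pow_four (p : Heisenberg n) :
    koranyiNorm p ^ 4 = (∑ i, (p.x i ^ 2 + p.y i ^ 2)) ^ 2 + p.t ^ 2 := by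
  rw [koranyiNorm, ← Real.rpow_natCast, ← Real.rpow_mul (by positivity)]
  norm_num

theorem abs_t_le_koranyiNorm_sq (p : Heisenberg n) : |p.t| ≤ koranyiNorm p ^ 2 := by
  refine abs_le_of_sq_le_sq ?_ (sq_nonneg _)
  rw [← pow_mul, koranyiNorm_pow_four]
  exact le_add_of_nonneg_left (sq_nonneg _)

theorem sqrt_sum_le_koranyiNorm (p : Heisenberg n) :
    √(∑ i, (p.x i ^ 2 + p.y i ^ 2)) ≤ koranyiNorm p := by
  refine Real.sqrt_le_iff.2 ⟨koranyiNorm_nonneg p, ?_⟩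
  refine (abs_le_of_sq_le_sq' ?_ (sq_nonneg _)).2
  rw [← pow_mul, koranyiNorm_pow_four]
  exact le_add_of_nonneg_right (sq_nonneg _)

theorem norm_horizontalPart_le (p : Heisenberg n) : ‖horizontalPart p‖ ≤ koranyiNorm p := by
  refine norm_prod_le_iff.2 ⟨?_, ?_⟩ <;>
    refine (pi_norm_le_iff_of_nonneg (koranyiNorm_nonneg p)).2 fun i => ?_
  · exact (abs_le_sqrt_sum p.x p.y i).1.trans (sqrt_sum_le_koranyiNorm p)
  · exact (abs_le_sqrt_sum p.x p.y i).2.trans (sqrt_sum_le_koranyiNorm p)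

/-- Together with `norm_horizontalPart_le` and `abs_t_le_koranyiNorm_sq`, this makes the gauge
comparable to the larger of `‖horizontalPart p‖` and `√|p.t|`. The constant is crude. -/
theorem koranyiNorm_le {p : Heisenberg n} {a : ℝ} (ha : ‖horizontalPart p‖ ≤ a)
    (ht : |p.t| ≤ a ^ 2) : koranyiNorm p ≤ (2 * n + 1) * a := by
  have ha0 : 0 ≤ a := (norm_nonneg _).trans ha
  obtain ⟨hx, hy⟩ := norm_prod_le_iff.1 ha
  have hs : ∑ i, (p.x i ^ 2 + p.y i ^ 2) ≤ 2 * n * a ^ 2 := by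
    calc ∑ i, (p.x i ^ 2 + p.y i ^ 2) ≤ ∑ _i : Fin n, (a ^ 2 + a ^ 2) := by
          refine Finset.sum_le_sum fun i _ => add_le_add ?_ ?_
          · exact sq_le_sq.2 (((norm_le_pi_norm _ i).trans hx).trans (le_abs_self a))
          · exact sq_le_sq.2 (((norm_le_pi_norm _ i).trans hy).trans (le_abs_self a))
      _ = _ := by simp; ring
  have hs0 : 0 ≤ ∑ i, (p.x i ^ 2 + p.y i ^ 2) := by positivity
  have ht2 : p.t ^ 2 ≤ (a ^ 2) ^ 2 := by
    rw [← sq_abs]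
    gcongr
  refine le_of_pow_le_pow_left₀ four_ne_zero (by positivity) ?_
  rw [koranyiNorm_pow_four]
  calc (∑ i, (p.x i ^ 2 + p.y i ^ 2)) ^ 2 + p.t ^ 2 ≤ (2 * n * a ^ 2) ^ 2 + (a ^ 2) ^ 2 := by
        gcongr
    _ = ((2 * n) ^ 2 + 1) * a ^ 4 := by ring
    _ ≤ (2 * n + 1) ^ 4 * a ^ 4 := by
        gcongr
        have : (0 : ℝ) ≤ n := n.cast_nonneg
        have h1 : (1 : ℝ) ≤ (2 * n + 1) ^ 2 := by nlinarith
        nlinarith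
    _ = _ := by ring

theorem purelyUnrectifiable_koranyi {n k : ℕ} (hnk : n < k) :
    PurelyUnrectifiable k (Koranyi n) := by
  rintro E f - ⟨L, hL⟩
  set F : EuclideanSpace ℝ (Fin k) → (Fin n → ℝ) × (Fin n → ℝ) :=
    fun q => horizontalPart (f q).pt with hF
  set τ : EuclideanSpace ℝ (Fin k) → ℝ := fun q => (f q).pt.t with hτ
  have hdist : ∀ q q', dist (f q) (f q') = koranyiNorm ((f q).pt⁻¹ * (f q').pt) := fun q q' => by
    rw [dist_comm]
    rfl
  have hdef : ∀ q q', contactDefect (symplecticForm n) F τ q q' = ((f q).pt⁻¹ * (f q').pt).t :=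
    fun q q' => (inv_mul_t _ _).symm
  have hFsub : ∀ q q', horizontalPart ((f q).pt⁻¹ * (f q').pt) = F q' - F q :=
    fun q q' => horizontalPart_inv_mul _ _
  have hFL : LipschitzOnWith L F E := LipschitzOnWith.of_dist_le_mul fun q hq q' hq' => by
    refine le_trans ?_ (hL.dist_le_mul q hq q' hq')
    rw [dist_comm, dist_eq_norm, ← hFsub, hdist]
    exact norm_horizontalPart_le _
  have hτL : ∀ q ∈ E, ∀ q' ∈ E,
      |contactDefect (symplecticForm n) F τ q q'| ≤ (L : ℝ) ^ 2 * dist q q' ^ 2 := by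
    intro q hq q' hq'
    rw [hdef, ← mul_pow]
    refine (abs_t_le_koranyiNorm_sq _).trans ?_
    rw [← hdist]
    exact pow_le_pow_left₀ dist_nonneg (hL.dist_le_mul q hq q' hq') 2
  have hk : Module.finrank ℝ (EuclideanSpace ℝ (Fin k)) = k := finrank_euclideanSpace_fin
  -- In its own dimension the Hausdorff measure is a Haar measure; with this choice, the Lipschitz
  -- bound for images directly sends null sets to null sets.
  set μ : Measure (EuclideanSpace ℝ (Fin k)) :=
    Measure.hausdorffMeasure (Module.finrank ℝ (EuclideanSpace ℝ (Fin k)) : ℝ) with hμ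
  have main := hausdorffMeasure_image_eq_zero (f := f) (E := E) μ ?_ ?_
  · rwa [hk] at main
  · intro N hN hN0
    have := (hL.mono hN).hausdorffMeasure_image_le
      (Nat.cast_nonneg (α := ℝ) (Module.finrank ℝ (EuclideanSpace ℝ (Fin k))))
    rw [← hμ, hN0, mul_zero] at this
    exact le_antisymm this zero_le
  · filter_upwards [ae_asymptoticallyDenseAt μ E, hFL.ae_differentiableWithinAt_of_mem (μ := μ)]
      with p hp1 hp2 hp
    have hd := (hp2 hp).hasFDerivWithinAt
    rw [hk]
    refine hasSmallCovers_of_rank_lt (A := fderivWithin ℝ F E p) (C := 2 * n + 1)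
      (lt_of_le_of_lt (finrank_le_of_isotropic _ ?_) hnk) (by positivity) ?_
    · rintro _ ⟨v, rfl⟩ _ ⟨w, rfl⟩
      exact bilin_fderivWithin_eq_zero symplecticForm_self hτL (by positivity) hp (hp1 hp) hd v w
    · intro ε hε
      filter_upwards [eventually_norm_sub_le_and_abs_contactDefect_le symplecticForm_self hτL
        (by positivity) hp (hp1 hp) hd hε, self_mem_nhdsWithin] with r hr hr0 q hq hqp q' hq' hqp'
      have hr0' : (0 : ℝ) < r := hr0
      obtain ⟨h1, h2⟩ := hr q hq hqp q' hq' hqp'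
      rw [edist_dist, hdist]
      refine ENNReal.ofReal_le_ofReal (koranyiNorm_le (by rwa [hFsub]) ?_)
      rw [← hdef]
      refine h2.trans (pow_le_pow_left₀ (by positivity) ?_ 2)
      exact le_add_of_nonneg_left (norm_nonneg _)

/-! ### Comparison with the Carnot–Carathéodory metric -/

theorem ac_sum {ι : Type*} (s : Finset ι) {f : ι → ℝ → ℝ} {a b : ℝ}
    (hf : ∀ i ∈ s, AbsolutelyContinuousOnInterval (f i) a b) :
    AbsolutelyContinuousOnInterval (fun r => ∑ i ∈ s, f i r) a b := by
  classical
  induction s using Finset.induction_on with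
  | empty =>
    simpa using (LipschitzWith.const (0 : ℝ)).lipschitzOnWith.absolutelyContinuousOnInterval
  | insert i s hi ih =>
    simp only [Finset.sum_insert hi]
    exact (hf i (Finset.mem_insert_self i s)).add
      (ih fun j hj => hf j (Finset.mem_insert_of_mem hj))

/-- After left translation of `γ a` to the origin, a curve of length `ℓ` keeps its horizontal
coordinates within `ℓ`, so its height changes at most at rate `4 n ℓ` times the speed. The total
height is at most `4 n ℓ²`, the right order for the Korányi gauge. -/
theorem IsHorizontalCurve.koranyiDist_le {γ : ℝ → Heisenberg n} {u v : ℝ → Fin n → ℝ} {a b : ℝ}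
    (h : IsHorizontalCurve γ u v a b) :
    ENNReal.ofReal (koranyiDist (γ b) (γ a))
      ≤ ((2 * n + 1) * (4 * n + 1) : ℝ≥0) * horizontalLength u v a b := by
  by_cases htop : horizontalLength u v a b = ⊤
  · rw [htop, ENNReal.mul_top (by positivity)]
    exact le_top
  obtain ⟨ℓ, hℓ⟩ : ∃ ℓ : ℝ≥0, (ℓ : ℝ≥0∞) = horizontalLength u v a b :=
    ⟨_, ENNReal.coe_toNNReal htop⟩
  have hxy : ∀ s ∈ Icc a b, ∀ i, |(γ s).x i - (γ a).x i| ≤ ℓ ∧ |(γ s).y i - (γ a).y i| ≤ ℓ := by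
    intro s hs i
    have h1 := h.edist_xy_le hs i
    rw [← hℓ, edist_le_coe, edist_le_coe, ← NNReal.coe_le_coe, ← NNReal.coe_le_coe, coe_nndist,
      coe_nndist, Real.dist_eq, Real.dist_eq] at h1
    exact h1
  have hb : b ∈ Icc a b := ⟨h.le, le_rfl⟩
  -- Up to the constant `g a`, this is the last coordinate of `(γ a)⁻¹ * γ s`.
  set g : ℝ → ℝ := fun s => (γ s).t
    - 2 * ∑ i, ((γ a).y i * (γ s).x i - (γ a).x i * (γ s).y i) with hg
  have hac : AbsolutelyContinuousOnInterval g a b :=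
    h.ac_t.sub ((ac_sum _ fun i _ =>
      ((h.ac_x i).const_mul ((γ a).y i)).sub ((h.ac_y i).const_mul ((γ a).x i))).const_mul 2)
  have hgd := edist_le_of_ac (f := g) (ℓ := fun r => √(∑ i, (u r i ^ 2 + v r i ^ 2)))
    (g := fun s => ∑ i, (u s i * (2 * (γ s).y i) + v s i * (-(2 * (γ s).x i)))
      - 2 * ∑ i, ((γ a).y i * u s i - (γ a).x i * v s i)) (4 * n * ℓ) h.le hac ?_ ?_
  · change edist (g b) (g a) ≤ _ * horizontalLength u v a b at hgd
    rw [← hℓ, ← ENNReal.coe_mul, edist_le_coe, ← NNReal.coe_le_coe, coe_nndist, Real.dist_eq] at hgd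
    have hga : g a = (γ a).t := by simp [hg, mul_comm]
    have ht : ((γ a)⁻¹ * γ b).t = g b - g a := by
      rw [hga, inv_mul_t, symplecticForm_apply]
      simp only [hg, horizontalPart]
      ring
    have hn0 : (0 : ℝ) ≤ n := n.cast_nonneg
    have hℓ0 : (0 : ℝ) ≤ ℓ := ℓ.coe_nonneg
    have hle : (ℓ : ℝ) ≤ (4 * n + 1) * ℓ := le_mul_of_one_le_left hℓ0 (by linarith)
    have hK : koranyiDist (γ b) (γ a) ≤ (2 * n + 1) * ((4 * n + 1) * ℓ) := by
      refine koranyiNorm_le ?_ ?_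
      · refine le_trans ?_ hle
        rw [horizontalPart_inv_mul]
        refine norm_prod_le_iff.2 ⟨?_, ?_⟩ <;>
          refine (pi_norm_le_iff_of_nonneg hℓ0).2 fun i => ?_
        · exact (hxy b hb i).1
        · exact (hxy b hb i).2
      · rw [ht]
        refine hgd.trans ?_
        push_cast
        have h1 : 4 * (n : ℝ) * (ℓ * ℓ) ≤ (4 * n + 1) ^ 2 * (ℓ * ℓ) := by
          gcongr
          nlinarith
        linarith
    rw [← hℓ, ← ENNReal.coe_mul, ← ENNReal.ofReal_coe_nnreal]
    refine ENNReal.ofReal_le_ofReal (hK.trans (le_of_eq ?_))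
    push_cast
    ring
  · filter_upwards [h.deriv_x, h.deriv_y, h.deriv_t] with s hx hy ht hs
    refine (ht hs).sub (HasDerivAt.const_mul 2 (HasDerivAt.fun_sum fun i _ => ?_))
    exact ((hx hs i).const_mul _).sub ((hy hs i).const_mul _)
  · intro s hs
    have e : ∑ i, (u s i * (2 * (γ s).y i) + v s i * (-(2 * (γ s).x i)))
        - 2 * ∑ i, ((γ a).y i * u s i - (γ a).x i * v s i)
        = ∑ i, (2 * (u s i * ((γ s).y i - (γ a).y i)) - 2 * (v s i * ((γ s).x i - (γ a).x i))) := by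
      rw [Finset.mul_sum, ← Finset.sum_sub_distrib]
      exact Finset.sum_congr rfl fun i _ => by ring
    rw [e]
    refine (Finset.abs_sum_le_sum_abs _ _).trans ?_
    refine (Finset.sum_le_card_nsmul _ _ (4 * ℓ * √(∑ i, (u s i ^ 2 + v s i ^ 2))) ?_).trans ?_
    · intro i _
      obtain ⟨h1, h2⟩ := abs_le_sqrt_sum (u s) (v s) i
      obtain ⟨h3, h4⟩ := hxy s hs i
      have h5 := mul_le_mul h1 h4 (abs_nonneg _) (Real.sqrt_nonneg _)
      have h6 := mul_le_mul h2 h3 (abs_nonneg _) (Real.sqrt_nonneg _)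
      refine (abs_sub _ _).trans ?_
      rw [abs_mul, abs_mul, abs_mul, abs_mul, abs_two]
      linarith
    · rw [Finset.card_univ, Fintype.card_fin, nsmul_eq_mul]
      push_cast
      exact le_of_eq (by ring)

theorem koranyiDist_le_ccDist (p q : Heisenberg n) :
    ENNReal.ofReal (koranyiDist q p) ≤ ((2 * n + 1) * (4 * n + 1) : ℝ≥0) * ccDist p q := by
  have hC : ((2 * n + 1) * (4 * n + 1) : ℝ≥0) ≠ 0 := by positivity
  rw [mul_comm, ← ENNReal.div_le_iff (by exact_mod_cast hC) ENNReal.coe_ne_top]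
  refine le_sInf ?_
  rintro _ ⟨γ, u, v, a, b, h, rfl, rfl, rfl⟩
  rw [ENNReal.div_le_iff (by exact_mod_cast hC) ENNReal.coe_ne_top, mul_comm]
  exact h.koranyiDist_le

theorem ccDist_mul_le (p : Heisenberg n) (u v : Fin n → ℝ) :
    ccDist p (p * ⟨u, v, 0⟩) ≤ ENNReal.ofReal √(∑ i, (u i ^ 2 + v i ^ 2)) := by
  have h := ccDist_le (isHorizontalCurve_line p u v)
  have h0 : p * (⟨0, 0, 0⟩ : Heisenberg n) = p := mul_one p
  simp only [one_smul, zero_smul, h0] at h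
  refine h.trans (le_of_eq ?_)
  simp [horizontalLength]

/-- A vertical displacement is a commutator of horizontal ones. -/
theorem ccDist_mul_vertical_le (hn : 0 < n) (p : Heisenberg n) (t : ℝ) :
    ccDist p (p * ⟨0, 0, t⟩) ≤ ENNReal.ofReal (2 * √|t|) := by
  -- The commutator of horizontal steps `α` in `y` and `β` in `x` rises by `4 α β`. Four legs of
  -- length `√|t| / 2` cost `2 √|t|`; the sign of `t` is carried by `β`.
  obtain ⟨α, β, hαβ, hα, hβ⟩ : ∃ α β : ℝ, 4 * α * β = t ∧ |α| = √|t| / 2 ∧ |β| = √|t| / 2 := by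
    have hs : √|t| * √|t| = |t| := Real.mul_self_sqrt (abs_nonneg t)
    have hs0 := Real.sqrt_nonneg |t|
    rcases le_total 0 t with ht | ht
    · refine ⟨√|t| / 2, √|t| / 2, ?_, abs_of_nonneg (by positivity), abs_of_nonneg (by positivity)⟩
      rw [abs_of_nonneg ht] at hs ⊢
      linarith
    · refine ⟨√|t| / 2, -(√|t| / 2), ?_, abs_of_nonneg (by positivity), ?_⟩
      · rw [abs_of_nonpos ht] at hs ⊢
        linarith
      · rw [abs_neg, abs_of_nonneg (by positivity)]
  set e : Fin n → ℝ := Pi.single ⟨0, hn⟩ 1 with he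
  have hcost : ∀ c : ℝ, |c| = √|t| / 2 →
      (∀ q : Heisenberg n, ccDist q (q * ⟨c • e, 0, 0⟩) ≤ ENNReal.ofReal (√|t| / 2)) ∧
      (∀ q : Heisenberg n, ccDist q (q * ⟨0, c • e, 0⟩) ≤ ENNReal.ofReal (√|t| / 2)) := by
    intro c hc
    have h1 : ∑ i, (c • e) i ^ 2 = c ^ 2 := by
      simp [he, Pi.single_apply]
    have h2 : √(c ^ 2) = √|t| / 2 := by rw [Real.sqrt_sq_eq_abs, hc]
    constructor
    · intro q
      refine (ccDist_mul_le q (c • e) 0).trans (le_of_eq ?_)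
      rw [← h2, ← h1]
      simp
    · intro q
      refine (ccDist_mul_le q 0 (c • e)).trans (le_of_eq ?_)
      rw [← h2, ← h1]
      simp
  have hend : p * ⟨0, α • e, 0⟩ * ⟨β • e, 0, 0⟩ * ⟨0, (-α) • e, 0⟩ * ⟨(-β) • e, 0, 0⟩
      = p * ⟨0, 0, t⟩ := by
    simp only [mul_assoc]
    congr 1
    have hsum : ∑ i, e i * e i = 1 := by simp [he, Pi.single_apply]
    ext i
    · simp
    · simp
    · have : ∀ c d : ℝ, ∑ i, c * e i * (d * e i) = c * d := by
        intro c d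
        rw [← mul_one (c * d), ← hsum, Finset.mul_sum]
        exact Finset.sum_congr rfl fun i _ => by ring
      simp only [mul_t, mul_x, mul_y, Pi.add_apply, Pi.smul_apply, Pi.zero_apply, smul_eq_mul,
        zero_add, add_zero, zero_mul, mul_zero, sub_zero, zero_sub, Finset.sum_neg_distrib,
        mul_add, Finset.sum_add_distrib, this]
      linarith
  have hα' : |-α| = √|t| / 2 := by rw [abs_neg, hα]
  have hβ' : |-β| = √|t| / 2 := by rw [abs_neg, hβ]
  rw [← hend]
  refine (ccDist_triangle _ _ _).trans ((add_le_add ((ccDist_triangle _ _ _).trans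
    (add_le_add ((ccDist_triangle _ _ _).trans (add_le_add ((hcost α hα).2 p)
      ((hcost β hβ).1 _))) ((hcost _ hα').2 _))) ((hcost _ hβ').1 _)).trans ?_)
  have hs0 := Real.sqrt_nonneg |t|
  rw [← ENNReal.ofReal_add (by positivity) (by positivity),
    ← ENNReal.ofReal_add (by positivity) (by positivity),
    ← ENNReal.ofReal_add (by positivity) (by positivity)]
  exact ENNReal.ofReal_le_ofReal (by linarith)

/-- The quotient `p⁻¹ * q` is a horizontal element times a vertical one; the horizontal segment
costs at most one gauge and the vertical commutator two. -/
theorem ccDist_le_koranyiDist (hn : 0 < n) (p q : Heisenberg n) :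
    ccDist p q ≤ ENNReal.ofReal (3 * koranyiDist q p) := by
  set g : Heisenberg n := p⁻¹ * q with hg
  have hsplit : p * ⟨g.x, g.y, 0⟩ * ⟨0, 0, g.t⟩ = q := by
    have h1 : (⟨g.x, g.y, 0⟩ : Heisenberg n) * ⟨0, 0, g.t⟩ = g := by
      ext i <;> simp
    rw [mul_assoc, h1, hg, mul_inv_cancel_left]
  have h2 : √|g.t| ≤ koranyiNorm g :=
    Real.sqrt_le_iff.2 ⟨koranyiNorm_nonneg g, abs_t_le_koranyiNorm_sq g⟩
  calc ccDist p q = ccDist p (p * ⟨g.x, g.y, 0⟩ * ⟨0, 0, g.t⟩) := by rw [hsplit]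
    _ ≤ ENNReal.ofReal √(∑ i, (g.x i ^ 2 + g.y i ^ 2)) + ENNReal.ofReal (2 * √|g.t|) :=
      (ccDist_triangle _ _ _).trans
        (add_le_add (ccDist_mul_le p g.x g.y) (ccDist_mul_vertical_le hn _ g.t))
    _ = ENNReal.ofReal (√(∑ i, (g.x i ^ 2 + g.y i ^ 2)) + 2 * √|g.t|) :=
      (ENNReal.ofReal_add (by positivity) (by positivity)).symm
    _ ≤ ENNReal.ofReal (3 * koranyiNorm g) :=
      ENNReal.ofReal_le_ofReal (by linarith [sqrt_sum_le_koranyiNorm g])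

/-- The identity is Lipschitz in both directions: one direction turns `f` into a Lipschitz map for
the Korányi metric, the other carries the null image back. -/
theorem purelyUnrectifiable_cc {n k : ℕ} (hn : 0 < n) (hnk : n < k) :
    PurelyUnrectifiable k (CC n) := by
  rintro E f hE ⟨L, hL⟩
  have h1 : LipschitzWith ((2 * n + 1) * (4 * n + 1)) (fun p : CC n => (⟨p.pt⟩ : Koranyi n)) := by
    intro p q
    rw [edist_comm p q, edist_dist]
    exact koranyiDist_le_ccDist q.pt p.pt
  have h2 : LipschitzWith 3 (fun p : Koranyi n => (⟨p.pt⟩ : CC n)) := by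
    intro p q
    refine (ccDist_le_koranyiDist hn p.pt q.pt).trans (le_of_eq ?_)
    rw [ENNReal.ofReal_mul (by norm_num), edist_comm, edist_dist]
    simp [dist]
  have h3 := purelyUnrectifiable_koranyi hnk E (fun q => ⟨(f q).pt⟩) hE
    ⟨_, h1.comp_lipschitzOnWith hL⟩
  have h4 := h2.hausdorffMeasure_image_le (Nat.cast_nonneg (α := ℝ) k)
    ((fun q => (⟨(f q).pt⟩ : Koranyi n)) '' E)
  rw [h3, mul_zero, image_image] at h4
  exact le_antisymm h4 zero_le

end Heisenberg

theorem theorem3p2 (n k : ℕ) (hn : 0 < n) (hnk : n < k) :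
    PurelyUnrectifiable k (Heisenberg.CC n) ∧ PurelyUnrectifiable k (Heisenberg.Koranyi n) :=
  ⟨Heisenberg.purelyUnrectifiable_cc hn hnk, Heisenberg.purelyUnrectifiable_koranyi hnk⟩
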